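/- **Setting.** Let $\nu$ be a measure on $\mathbb R$, let $A(s)=\log\int e^{sy}\,\nu(dy)$, and for $s$ in the natural parameter space $\{s:\int e^{sy}\nu(dy)<\infty\}$ let $P_s(dy)=e^{sy-A(s)}\,\nu(dy)$ be the corresponding one-parameter exponential family. Let $D$ be a parameter set contained in the natural parameter space and let $s^0$ be an interior point of $D$; the family is standardized so that $A'(s^0)=0$ and $A''(s^0)=1$. One observes an $N\times M$ matrix $Y$ with independent entries $Y_{ij}\sim P_{s_{ij}}$, $s_{ij}\in D$. Let $\mathcal C_{nm}$ be the collection of sets $C=A\times B$ with $A\subset\{1,\dots,N\}$, $\#A=n$, $B\subset\{1,\dots,M\}$, $\#B=m$. The null hypothesis is that all $s_{ij}=s^0$; for $a>0$ the alternative $\mathcal S_{nm,a}$ consists of all matrices $S=(s_{ij})$ with entries in $D$ for which there is $C\in\mathcal C_{nm}$ with $s_{ij}=s^0$ for $(i,j)\notin C$ and $s_{ij}-s^0\ge a$ for $(i,j)\in C$. Write $P_0$ and $P_S$ for the corresponding laws of $Y$, and $E_0$, $E_S$ for the expectations. A test is a measurable function $\psi=\psi(Y)$ with values in $[0,1]$;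 put $$\alpha(\psi)=E_0\psi,\qquad \beta_{nm,a}(\psi)=\sup_{S\in\mathcal S_{nm,a}}E_S(1-\psi),\qquad \gamma_{nm,a}(\psi)=\alpha(\psi)+\beta_{nm,a}(\psi),$$ $$\gamma_{nm,a}=\inf_\psi\gamma_{nm,a}(\psi),\qquad \beta_{nm,a,\alpha}=\inf_{\psi:\ \alpha(\psi)\le\alpha}\beta_{nm,a}(\psi).$$ For $H\in\mathbb R$ and $\delta>0$ let $\psi^*$ be the test that rejects (takes the value $1$, and $0$ otherwise) if $$\frac1{\sqrt{NM}}\sum_{i,j}Y_{ij}>H\qquad\text{or}\qquad \max_{C\in\mathcal C_{nm}}\frac1{\sqrt{nm}}\sum_{(i,j)\in C}Y_{ij}>T_{nm},\qquad T_{nm}=\sqrt{(2+\delta)\log\left(\binom Nn\binom Mm\right)}.$$ **Asymptotics.** The family, $D$ and $s^0$ are fixed; $N,M,n,m\to\infty$, and $a>0$ and $H$ may vary along with them. Put $p=n/N$, $q=m/M$. Assume $p\to0$, $q\to0$ and $$\frac{\log(p^{-1})}{m}+\frac{\log(q^{-1})}{n}\to0 .$$ **Theorem.** *Upper bounds.*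 Suppose that, eventually, $s^0+a$ lies in the interior of the natural parameter space. (i) If $A'(s^0+a)\sqrt{nmpq}\to\infty$, then for all sufficiently small fixed $\delta>0$, and for every $H\to\infty$ such that eventually $H<c\,A'(s^0+a)\sqrt{nmpq}$ for some constant $0<c<1$, one has $\gamma_{nm,a}(\psi^*)\to0$. (ii) If $$\liminf\frac{A'(s^0+a)\sqrt{nm}}{\sqrt{2\,(n\log(p^{-1})+m\log(q^{-1}))}}>1,$$ then for all sufficiently small fixed $\delta>0$ and every $H\to\infty$, one has $\gamma_{nm,a}(\psi^*)\to0$. *Lower bounds.* Assume moreover that $$\frac{\log\log(p^{-1})}{\log(q^{-1})}\to0,\qquad \frac{\log\log(q^{-1})}{\log(p^{-1})}\to0,\qquad n\log(p^{-1})\asymp m\log(q^{-1}).$$ If $$a\sqrt{nmpq}\to0\qquad\text{and}\qquad \limsup\frac{a\sqrt{nm}}{\sqrt{2\,(n\log(p^{-1})+m\log(q^{-1}))}}<1,$$ then $\gamma_{nm,a}\to1$, and $\beta_{nm,a,\alpha}\to1-\alpha$ for every $\alpha\in(0,1)$. -/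

import Mathlib

open MeasureTheory ProbabilityTheory Filter Topology Asymptotics

noncomputable section

namespace SubmatrixDetection

/-- The cumulant function `A(s) = log ∫ exp (s y) ν(dy)` of the exponential family generated by the
measure `ν` on the line (`ν` stands for `h(y) μ(dy)`, with `μ` the dominating measure). -/
def cumulant (ν : Measure ℝ) : ℝ → ℝ := cgf id ν

/-- The natural parameter space `{s | ∫ exp (s y) ν(dy) < ∞}` of the family. -/
def naturalSpace (ν : Measure ℝ) : Set ℝ := integrableExpSet id ν

/-- The member of the exponential family with parameter `s`: the law with density
`exp (s y - A(s))` with respect to `ν`. -/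
def expLaw (ν : Measure ℝ) (s : ℝ) : Measure ℝ :=
  ν.withDensity fun y => ENNReal.ofReal (Real.exp (s * y - cumulant ν s))

/-- The law `P_S` of an `N × M` matrix with independent entries, where the entry `(i, j)` has
parameter `S (i, j)`. -/
def matrixLaw (ν : Measure ℝ) {N M : ℕ} (S : Fin N × Fin M → ℝ) :
    Measure (Fin N × Fin M → ℝ) :=
  Measure.pi fun ij => expLaw ν (S ij)

/-- The law `P_0` of the observations under the null hypothesis: all parameters equal `s0`. -/
def nullLaw (ν : Measure ℝ) (s0 : ℝ) (N M : ℕ) : Measure (Fin N × Fin M → ℝ) :=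
  matrixLaw ν fun _ => s0

/-- The collection of all sets `C = A × B` with `#A = n` rows and `#B = m` columns. -/
def submatrices (N M n m : ℕ) : Set (Finset (Fin N × Fin M)) :=
  {C | ∃ (A : Finset (Fin N)) (B : Finset (Fin M)), A.card = n ∧ B.card = m ∧ C = A ×ˢ B}

/-- The alternative: all parameter matrices with entries in the parameter set `D` that are equal to
`s0` outside some `n × m` submatrix, and at least `s0 + a` on it. -/
def alternative (D : Set ℝ) (s0 : ℝ) (N M n m : ℕ) (a : ℝ) : Set (Fin N × Fin M → ℝ) :=
  {S | (∀ ij, S ij ∈ D) ∧ ∃ C ∈ submatrices N M n m,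
    (∀ ij, ij ∉ C → S ij = s0) ∧ ∀ ij, ij ∈ C → a ≤ S ij - s0}

/-- A test is a measurable function of the observations with values in `[0, 1]`. -/
def IsTest {N M : ℕ} (ψ : (Fin N × Fin M → ℝ) → ℝ) : Prop :=
  Measurable ψ ∧ ∀ Y, 0 ≤ ψ Y ∧ ψ Y ≤ 1

/-- The first-type error `α(ψ) = E_0 ψ`. -/
def typeOneError (ν : Measure ℝ) (s0 : ℝ) {N M : ℕ} (ψ : (Fin N × Fin M → ℝ) → ℝ) : ℝ :=
  ∫ Y, ψ Y ∂nullLaw ν s0 N M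

/-- The second-type error `β(ψ, S) = E_S (1 - ψ)` at the parameter matrix `S`. -/
def typeTwoError (ν : Measure ℝ) {N M : ℕ} (ψ : (Fin N × Fin M → ℝ) → ℝ)
    (S : Fin N × Fin M → ℝ) : ℝ :=
  ∫ Y, (1 - ψ Y) ∂matrixLaw ν S

/-- The maximal second-type error of a test over the alternative. -/
def maxTypeTwoError (ν : Measure ℝ) (D : Set ℝ) (s0 : ℝ) {N M : ℕ} (n m : ℕ) (a : ℝ)
    (ψ : (Fin N × Fin M → ℝ) → ℝ) : ℝ :=
  ⨆ S : alternative D s0 N M n m a, typeTwoError ν ψ S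

/-- The global testing error of a test: first-type error plus maximal second-type error. -/
def globalError (ν : Measure ℝ) (D : Set ℝ) (s0 : ℝ) {N M : ℕ} (n m : ℕ) (a : ℝ)
    (ψ : (Fin N × Fin M → ℝ) → ℝ) : ℝ :=
  typeOneError ν s0 ψ + maxTypeTwoError ν D s0 n m a ψ

/-- The minimax global testing risk: the infimum of the global testing error over all tests. -/
def minimaxGlobalError (ν : Measure ℝ) (D : Set ℝ) (s0 : ℝ) (N M n m : ℕ) (a : ℝ) : ℝ :=
  ⨅ ψ : {ψ : (Fin N × Fin M → ℝ) → ℝ // IsTest ψ}, globalError ν D s0 n m a ψ.1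

/-- The minimax second-type error at level `α`: the infimum of the maximal second-type error over
all tests with first-type error at most `α`. -/
def minimaxTypeTwoError (ν : Measure ℝ) (D : Set ℝ) (s0 : ℝ) (N M n m : ℕ) (a α : ℝ) : ℝ :=
  ⨅ ψ : {ψ : (Fin N × Fin M → ℝ) → ℝ // IsTest ψ ∧ typeOneError ν s0 ψ ≤ α},
    maxTypeTwoError ν D s0 n m a ψ.1

/-- The linear statistic `t_lin`: the sum of all entries, divided by `√(N M)`. -/
def linStat {N M : ℕ} (Y : Fin N × Fin M → ℝ) : ℝ :=
  (∑ ij, Y ij) / √((N : ℝ) * M)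

/-- The scan statistic `t_max`: the maximum over all `n × m` submatrices `C` of the sum of the
entries in `C`, divided by `√(n m)`. -/
def scanStat {N M : ℕ} (n m : ℕ) (Y : Fin N × Fin M → ℝ) : ℝ :=
  ⨆ C : submatrices N M n m, (∑ ij ∈ C.1, Y ij) / √((n : ℝ) * m)

/-- The scan threshold `√((2 + δ) log (N.choose n * M.choose m))`. -/
def scanThreshold (δ : ℝ) (N M n m : ℕ) : ℝ :=
  √((2 + δ) * Real.log ((N.choose n : ℝ) * (M.choose m : ℝ)))

open scoped Classical in
/-- The linear test: the indicator of `t_lin > H`. -/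
def linTest {N M : ℕ} (H : ℝ) (Y : Fin N × Fin M → ℝ) : ℝ :=
  if H < linStat Y then 1 else 0

open scoped Classical in
/-- The scan test: the indicator of `t_max > T`. -/
def scanTest {N M : ℕ} (n m : ℕ) (T : ℝ) (Y : Fin N × Fin M → ℝ) : ℝ :=
  if T < scanStat n m Y then 1 else 0

/-- The combined test `ψ*`: the maximum of the linear test with threshold `H` and the scan test with
threshold `√((2 + δ) log (N.choose n * M.choose m))`. -/
def combinedTest (δ H : ℝ) (N M n m : ℕ) (Y : Fin N × Fin M → ℝ) : ℝ :=
  max (linTest H Y) (scanTest n m (scanThreshold δ N M n m) Y)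

end SubmatrixDetection

end

open SubmatrixDetection

/-! The upper bounds are Chernoff bounds. Near `s0` the cumulant function A has A'' < K with K close
to 1 (`exists_quadraticBound`), so small tilts act as for Gaussian data. Under the null law the
linear test costs exp(K/2 - H), and the union bound over the G = C(N,n) C(M,m) submatrices costs G ·
G^(-(1 - K/2)(2 + δ)), which vanishes once K is close enough to 1. Under an alternative the entries
of the planted submatrix may have parameters far from `s0`. Convexity of A makes its increments over
a fixed step monotone (`cumulant_sub_le`), so each such parameter can be replaced by a smaller point
b near `s0`. With b = s0 + a the missed-detection bounds are exp(H - A'(b)√(nmpq) + K/2) and exp(T -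
A'(b)√(nm) + K/2). If a is not small, b = s0 + ρ is used, and the scan test alone suffices because T
= o(√(nm)).

The lower bounds come from the uniform mixture of the laws with parameter exactly s0 + a on a random
submatrix. If its likelihood ratio is close to 1 in L²(P_0), no test does essentially better than a
constant one. The plain second moment may be dominated by rare pairs of strongly overlapping
submatrices, so each likelihood is first cut off where some large block inside its submatrix has a
sum far above its planted mean (`one_sub_le_maxTypeTwoError`). With κ = K a², two submatrices with k
common rows and l common columns have cross moment at most exp(κkl), improved to exp(κkl/2 + small)
when the cutoff acts (`integral_truncated_mul_le`). The numbers k and l are independent, with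
exponential moments below those of Poisson variables of means np and mq (`sum_exp_card_inter_le`).

Three ranges remain (`pair_weight_le`). For l ≤ δm, averaging over k leaves a factor exp(2npκl) up
to a negligible term, and the total is 1 + o(1) because κnmpq → 0. For l > δm and k ≤ δn, κkl ≤ l
log(1/q)/2 is beaten by the rarity q^l of such overlaps. When both are large, κkl/2 ≤ (1 - η)(k
log(1/p) + l log(1/q)) is beaten by p^k q^l. -/

namespace SubmatrixDetection

/-! ### Exponential families and their cumulant function -/

lemma exp_cumulant {ν : Measure ℝ} [NeZero ν] {s : ℝ} (hs : s ∈ naturalSpace ν) :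
    Real.exp (cumulant ν s) = ∫ y, Real.exp (s * y) ∂ν := by
  have h : Integrable (fun y => Real.exp (s * id y)) ν := hs
  simpa [cumulant, mgf] using exp_cgf h

lemma measurable_expLaw_density (ν : Measure ℝ) (s : ℝ) :
    Measurable fun y : ℝ => ENNReal.ofReal (Real.exp (s * y - cumulant ν s)) := by
  fun_prop

lemma isProbabilityMeasure_expLaw {ν : Measure ℝ} [NeZero ν] {s : ℝ} (hs : s ∈ naturalSpace ν) :
    IsProbabilityMeasure (expLaw ν s) := by
  have hint : Integrable (fun y => Real.exp (s * y)) ν := hs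
  refine ⟨?_⟩
  rw [expLaw, withDensity_apply _ MeasurableSet.univ, Measure.restrict_univ,
    ← ofReal_integral_eq_lintegral_ofReal]
  · simp only [Real.exp_sub, integral_div]
    rw [← exp_cumulant hs, div_self (Real.exp_ne_zero _), ENNReal.ofReal_one]
  · simp only [Real.exp_sub]
    exact hint.div_const _
  · exact ae_of_all _ fun _ => (Real.exp_pos _).le

lemma expLaw_density_mul (ν : Measure ℝ) (s h y : ℝ) :
    (ENNReal.ofReal (Real.exp (s * y - cumulant ν s))).toReal • Real.exp (h * y) =
      Real.exp ((s + h) * y) / Real.exp (cumulant ν s) := by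
  rw [ENNReal.toReal_ofReal (Real.exp_pos _).le, smul_eq_mul, ← Real.exp_add, ← Real.exp_sub]
  ring_nf

lemma integrable_exp_expLaw {ν : Measure ℝ} {s h : ℝ} (hsh : s + h ∈ naturalSpace ν) :
    Integrable (fun y => Real.exp (h * y)) (expLaw ν s) := by
  rw [expLaw, integrable_withDensity_iff_integrable_smul' (measurable_expLaw_density ν s)
    (ae_of_all _ fun _ => ENNReal.ofReal_lt_top)]
  simp only [expLaw_density_mul]
  exact Integrable.div_const hsh _

lemma integral_exp_expLaw {ν : Measure ℝ} [NeZero ν] {s h : ℝ} (hsh : s + h ∈ naturalSpace ν) :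
    ∫ y, Real.exp (h * y) ∂expLaw ν s = Real.exp (cumulant ν (s + h) - cumulant ν s) := by
  rw [expLaw, integral_withDensity_eq_integral_toReal_smul (measurable_expLaw_density ν s)
    (ae_of_all _ fun _ => ENNReal.ofReal_lt_top)]
  simp only [expLaw_density_mul, integral_div]
  rw [← exp_cumulant hsh, Real.exp_sub]

lemma expLaw_eq_withDensity (ν : Measure ℝ) (s t : ℝ) :
    expLaw ν t = (expLaw ν s).withDensity fun y =>
      ENNReal.ofReal (Real.exp ((t - s) * y - (cumulant ν t - cumulant ν s))) := by
  rw [expLaw, expLaw, ← withDensity_mul _ (measurable_expLaw_density ν s) (by fun_prop)]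
  congr 1
  funext y
  rw [Pi.mul_apply, ← ENNReal.ofReal_mul (Real.exp_pos _).le, ← Real.exp_add]
  ring_nf

/-- The cumulant function is convex on the whole natural parameter space. -/
lemma convexOn_cumulant (ν : Measure ℝ) [NeZero ν] :
    ConvexOn ℝ (naturalSpace ν) (cumulant ν) := by
  refine ⟨convex_integrableExpSet, fun x hx z hz u v hu hv huv => ?_⟩
  have hw : u • x + v • z ∈ naturalSpace ν := convex_integrableExpSet hx hz hu hv huv
  have ix : Integrable (fun y => Real.exp (x * y)) ν := hx
  have iz : Integrable (fun y => Real.exp (z * y)) ν := hz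
  have iw : Integrable (fun y => Real.exp ((u • x + v • z) * y)) ν := hw
  -- Hölder's inequality by way of Young's: both exponentials are normalized to integral one, and
  -- the pointwise convexity of `exp` is then integrated.
  have key : ∀ y, Real.exp ((u • x + v • z) * y) /
        Real.exp (u * cumulant ν x + v * cumulant ν z) ≤
      u * (Real.exp (x * y) / Real.exp (cumulant ν x)) +
        v * (Real.exp (z * y) / Real.exp (cumulant ν z)) := by
    intro y
    have := convexOn_exp.2 (Set.mem_univ (x * y - cumulant ν x))
      (Set.mem_univ (z * y - cumulant ν z)) hu hv huv
    simp only [smul_eq_mul] at this ⊢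
    rw [← Real.exp_sub, ← Real.exp_sub, ← Real.exp_sub]
    refine le_trans (le_of_eq ?_) this
    ring_nf
  have hint := integral_mono (iw.div_const _)
    (((ix.div_const _).const_mul u).add ((iz.div_const _).const_mul v)) key
  simp only [Pi.add_apply] at hint
  rw [integral_add ((ix.div_const _).const_mul u) ((iz.div_const _).const_mul v),
    integral_const_mul, integral_const_mul, integral_div, integral_div, integral_div,
    ← exp_cumulant hx, ← exp_cumulant hz, ← exp_cumulant hw, div_self (Real.exp_ne_zero _),
    div_self (Real.exp_ne_zero _), mul_one, mul_one, huv, ← Real.exp_sub, Real.exp_le_one_iff]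
    at hint
  simpa [smul_eq_mul] using hint

/-- Increments of the cumulant function over steps of a given length are monotone. -/
lemma cumulant_sub_le {ν : Measure ℝ} [NeZero ν] {s b r : ℝ} (hr : 0 ≤ r) (hbs : b ≤ s)
    (hb : b - r ∈ naturalSpace ν) (hs : s ∈ naturalSpace ν) :
    s - r ∈ naturalSpace ν ∧
      cumulant ν (s - r) - cumulant ν s ≤ cumulant ν (b - r) - cumulant ν b := by
  rcases (by linarith : 0 ≤ s - (b - r)).eq_or_lt with h | h
  · have h1 : s = b := by linarith
    subst h1
    exact ⟨hb, le_rfl⟩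
  have hc := convexOn_cumulant ν
  -- Both `s - r` and `b` lie between `b - r` and `s`, as convex combinations with interchanged
  -- weights; adding the two convexity inequalities gives the claim.
  set w := s - (b - r) with hw
  have hu : 0 ≤ r / w := by positivity
  have hv : 0 ≤ (s - b) / w := div_nonneg (by linarith) h.le
  have huv : r / w + (s - b) / w = 1 := by
    rw [← add_div, div_eq_one_iff_eq h.ne']; rw [hw]; ring
  have e1 : (r / w) • (b - r) + ((s - b) / w) • s = s - r := by
    simp only [smul_eq_mul]; field_simp; rw [hw]; ring
  have e2 : ((s - b) / w) • (b - r) + (r / w) • s = b := by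
    simp only [smul_eq_mul]; field_simp; rw [hw]; ring
  refine ⟨e1 ▸ hc.1 hb hs hu hv huv, ?_⟩
  have h1 := hc.2 hb hs hu hv huv
  have h2 := hc.2 hb hs hv hu (by rw [add_comm]; exact huv)
  rw [e1] at h1
  rw [e2] at h2
  simp only [smul_eq_mul] at h1 h2
  have h3 : (s - b) / w = 1 - r / w := by linarith
  rw [h3] at h1 h2
  linarith

/-- The cumulant function is finite on `[s0 - r, s0 + r]` and lies below its second order expansions
with curvature `K` there. -/
def QuadraticBound (ν : Measure ℝ) (s0 K r : ℝ) : Prop :=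
  ∀ x ∈ Set.Icc (s0 - r) (s0 + r), x ∈ naturalSpace ν ∧ ∀ y ∈ Set.Icc (s0 - r) (s0 + r),
    cumulant ν y - cumulant ν x ≤ (y - x) * deriv (cumulant ν) x + K / 2 * (y - x) ^ 2

lemma QuadraticBound.mono {ν : Measure ℝ} {s0 K r r' : ℝ} (h : QuadraticBound ν s0 K r)
    (hr : r' ≤ r) : QuadraticBound ν s0 K r' := by
  have hsub : Set.Icc (s0 - r') (s0 + r') ⊆ Set.Icc (s0 - r) (s0 + r) :=
    Set.Icc_subset_Icc (by linarith) (by linarith)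
  exact fun x hx => ⟨(h x (hsub hx)).1, fun y hy => (h x (hsub hx)).2 y (hsub hy)⟩

lemma convexOn_tangent_le {s : Set ℝ} {f : ℝ → ℝ} (hf : ConvexOn ℝ s f) {x y d : ℝ} (hx : x ∈ s)
    (hy : y ∈ s) (hd : HasDerivAt f d x) : f x + (y - x) * d ≤ f y := by
  rcases lt_trichotomy x y with h | h | h
  · have := hf.le_slope_of_hasDerivAt hx hy h hd
    rw [slope_def_field, le_div_iff₀ (by linarith)] at this
    linarith
  · subst h; simp
  · have := hf.slope_le_of_hasDerivAt hy hx h hd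
    rw [slope_def_field, div_le_iff₀ (by linarith)] at this
    linarith

/-- A'' is continuous and equals 1 at `s0`, so A'' < K nearby and K/2 · x² - A(x) is convex there.
Its tangent line inequality is the quadratic bound, with any base point in the interval. -/
lemma exists_quadraticBound {ν : Measure ℝ} {s0 K : ℝ}
    (hs0 : s0 ∈ interior (naturalSpace ν)) (hA2 : iteratedDeriv 2 (cumulant ν) s0 = 1)
    (hK : 1 < K) : ∃ r > 0, QuadraticBound ν s0 K r := by
  have han : AnalyticAt ℝ (cumulant ν) s0 := analyticAt_cgf hs0
  have hc : ContinuousAt (deriv^[2] (cumulant ν)) s0 := by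
    rw [← iteratedDeriv_eq_iterate]
    exact (han.iterated_deriv 2 |>.continuousAt).congr
      (Eventually.of_forall fun x => by rw [iteratedDeriv_eq_iterate])
  have h1 : ∀ᶠ x in 𝓝 s0, deriv^[2] (cumulant ν) x < K := by
    refine hc.eventually_lt_const ?_
    rwa [← iteratedDeriv_eq_iterate, hA2]
  have h2 : ∀ᶠ x in 𝓝 s0, x ∈ interior (naturalSpace ν) := isOpen_interior.mem_nhds hs0
  obtain ⟨r, hr, hball⟩ := Metric.eventually_nhds_iff_ball.1 (h1.and h2)
  have hsub : Set.Icc (s0 - r / 2) (s0 + r / 2) ⊆ Metric.ball s0 r := by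
    rw [Real.ball_eq_Ioo]
    exact Set.Icc_subset_Ioo (by linarith) (by linarith)
  have hana : ∀ x ∈ Set.Icc (s0 - r / 2) (s0 + r / 2), AnalyticAt ℝ (cumulant ν) x :=
    fun x hx => analyticAt_cgf (hball x (hsub hx)).2
  have hd1 : ∀ x ∈ Set.Icc (s0 - r / 2) (s0 + r / 2),
      HasDerivAt (fun x => K / 2 * x ^ 2 - cumulant ν x) (K * x - deriv (cumulant ν) x) x := by
    intro x hx
    have := ((hasDerivAt_pow 2 x).const_mul (K / 2)).sub (hana x hx).differentiableAt.hasDerivAt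
    convert! this using 1
    simp; ring
  have hd2 : ∀ x ∈ Set.Icc (s0 - r / 2) (s0 + r / 2),
      HasDerivAt (fun x => K * x - deriv (cumulant ν) x) (K - deriv^[2] (cumulant ν) x) x := by
    intro x hx
    have := ((hasDerivAt_id x).const_mul K).sub (hana x hx).deriv.differentiableAt.hasDerivAt
    convert! this using 1
    simp
  have hconv : ConvexOn ℝ (Set.Icc (s0 - r / 2) (s0 + r / 2))
      (fun x => K / 2 * x ^ 2 - cumulant ν x) := by
    refine convexOn_of_hasDerivWithinAt2_nonneg (convex_Icc _ _)
      (fun x hx => (hd1 x hx).continuousAt.continuousWithinAt)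
      (fun x hx => (hd1 x (interior_subset hx)).hasDerivWithinAt)
      (fun x hx => (hd2 x (interior_subset hx)).hasDerivWithinAt) (fun x hx => ?_)
    have := (hball x (hsub (interior_subset hx))).1
    linarith
  refine ⟨r / 2, by positivity, fun x hx => ⟨interior_subset (hball x (hsub hx)).2, fun y hy => ?_⟩⟩
  have := convexOn_tangent_le hconv hx hy (hd1 x hx)
  nlinarith

/-- The derivative of the cumulant function is positive just to the right of `s0`. -/
lemma eventually_deriv_cumulant_pos {ν : Measure ℝ} {s0 : ℝ}
    (hs0 : s0 ∈ interior (naturalSpace ν)) (hA1 : deriv (cumulant ν) s0 = 0)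
    (hA2 : iteratedDeriv 2 (cumulant ν) s0 = 1) :
    ∀ᶠ r in 𝓝[>] (0 : ℝ), 0 < deriv (cumulant ν) (s0 + r) := by
  have han : AnalyticAt ℝ (cumulant ν) s0 := analyticAt_cgf hs0
  have hd : HasDerivAt (deriv (cumulant ν)) 1 s0 := by
    have := han.deriv.differentiableAt.hasDerivAt
    rwa [show deriv (deriv (cumulant ν)) s0 = 1 by rw [← hA2, iteratedDeriv_eq_iterate]; rfl]
      at this
  have h1 := hd.tendsto_slope
  have h2 := h1.eventually (lt_mem_nhds (show (0 : ℝ) < 1 by norm_num))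
  rw [eventually_nhdsWithin_iff] at h2 ⊢
  have h3 : Tendsto (fun r : ℝ => s0 + r) (𝓝 0) (𝓝 s0) := by
    simpa using (continuous_const_add s0).tendsto 0
  filter_upwards [h3.eventually h2] with r hr hr0
  have := hr (by simpa using (ne_of_gt hr0 : r ≠ 0))
  rw [slope_def_field, hA1, add_sub_cancel_left, sub_zero] at this
  have hr0' : (0 : ℝ) < r := hr0
  exact (div_pos_iff_of_pos_right hr0').1 this

/-! ### Laws of the matrix, exponential moments and likelihood ratios -/

/-- A product of densities is a density of the product measure. -/
lemma pi_withDensity {ι : Type*} [Fintype ι] {X : ι → Type*} [∀ i, MeasurableSpace (X i)]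
    (μ : ∀ i, Measure (X i)) [∀ i, SigmaFinite (μ i)] {f : ∀ i, X i → ℝ}
    (h0 : ∀ i x, 0 ≤ f i x) (hint : ∀ i, Integrable (f i) (μ i)) :
    Measure.pi (fun i => (μ i).withDensity fun x => ENNReal.ofReal (f i x)) =
      (Measure.pi μ).withDensity fun x => ENNReal.ofReal (∏ i, f i (x i)) := by
  have hfin : ∀ i, IsFiniteMeasure ((μ i).withDensity fun x => ENNReal.ofReal (f i x)) :=
    fun i => isFiniteMeasure_withDensity_ofReal (hint i).2
  -- Boxes determine a product measure, and the indicator of a box splits over the coordinates, so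
  -- it can be absorbed into the factors of the density.
  refine Measure.pi_eq fun s hs => ?_
  have hms : MeasurableSet (Set.univ.pi s) := MeasurableSet.univ_pi hs
  rw [withDensity_apply _ hms, ← lintegral_indicator hms]
  have h1 : ∀ x : (∀ i, X i), (Set.univ.pi s).indicator
      (fun x => ENNReal.ofReal (∏ i, f i (x i))) x =
      ENNReal.ofReal (∏ i, (s i).indicator (f i) (x i)) := by
    intro x
    classical
    by_cases hx : x ∈ Set.univ.pi s
    · rw [Set.indicator_of_mem hx]
      congr 1
      exact Finset.prod_congr rfl fun i _ => (Set.indicator_of_mem (hx i (Set.mem_univ i)) _).symm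
    · rw [Set.indicator_of_notMem hx]
      simp only [Set.mem_univ_pi, not_forall] at hx
      obtain ⟨i, hi⟩ := hx
      rw [Finset.prod_eq_zero (Finset.mem_univ i) (Set.indicator_of_notMem hi _),
        ENNReal.ofReal_zero]
  have hint' : ∀ i, Integrable ((s i).indicator (f i)) (μ i) := fun i => (hint i).indicator (hs i)
  have h0' : ∀ i x, 0 ≤ (s i).indicator (f i) x :=
    fun i x => Set.indicator_nonneg (fun x _ => h0 i x) x
  simp_rw [h1]
  rw [← ofReal_integral_eq_lintegral_ofReal (Integrable.fintype_prod_dep hint')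
    (ae_of_all _ fun x => Finset.prod_nonneg fun i _ => h0' i _),
    integral_fintype_prod_eq_prod (fun i => (s i).indicator (f i)),
    ENNReal.ofReal_prod_of_nonneg fun i _ => integral_nonneg (h0' i)]
  refine Finset.prod_congr rfl fun i _ => ?_
  rw [withDensity_apply _ (hs i), integral_indicator (hs i),
    ofReal_integral_eq_lintegral_ofReal (hint i).integrableOn (ae_of_all _ (h0 i))]

variable {ν : Measure ℝ} [NeZero ν] {N M : ℕ}

lemma isProbabilityMeasure_matrixLaw {S : Fin N × Fin M → ℝ} (hS : ∀ ij, S ij ∈ naturalSpace ν) :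
    IsProbabilityMeasure (matrixLaw ν S) := by
  have := fun ij => isProbabilityMeasure_expLaw (hS ij)
  unfold matrixLaw
  infer_instance

lemma integrable_exp_matrixLaw {S h : Fin N × Fin M → ℝ} (hS : ∀ ij, S ij ∈ naturalSpace ν)
    (hSh : ∀ ij, S ij + h ij ∈ naturalSpace ν) :
    Integrable (fun Y => Real.exp (∑ ij, h ij * Y ij)) (matrixLaw ν S) := by
  have := fun ij => isProbabilityMeasure_expLaw (hS ij)
  simp only [Real.exp_sum]
  exact Integrable.fintype_prod fun ij => integrable_exp_expLaw (hSh ij)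

lemma integral_exp_matrixLaw {S h : Fin N × Fin M → ℝ} (hS : ∀ ij, S ij ∈ naturalSpace ν)
    (hSh : ∀ ij, S ij + h ij ∈ naturalSpace ν) :
    ∫ Y, Real.exp (∑ ij, h ij * Y ij) ∂matrixLaw ν S =
      Real.exp (∑ ij, (cumulant ν (S ij + h ij) - cumulant ν (S ij))) := by
  have := fun ij => isProbabilityMeasure_expLaw (hS ij)
  simp only [Real.exp_sum, matrixLaw]
  rw [integral_fintype_prod_eq_prod (fun ij y => Real.exp (h ij * y))]
  exact Finset.prod_congr rfl fun ij _ => integral_exp_expLaw (hSh ij)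

/-- The likelihood ratio of `P_S` with respect to the null law. -/
noncomputable def likelihood (ν : Measure ℝ) (s0 : ℝ) {N M : ℕ} (S : Fin N × Fin M → ℝ)
    (Y : Fin N × Fin M → ℝ) : ℝ :=
  Real.exp (∑ ij, (S ij - s0) * Y ij - ∑ ij, (cumulant ν (S ij) - cumulant ν s0))

omit [NeZero ν] in
lemma measurable_likelihood (s0 : ℝ) (S : Fin N × Fin M → ℝ) :
    Measurable (likelihood ν s0 S) := by
  unfold likelihood
  fun_prop

lemma matrixLaw_eq_withDensity {s0 : ℝ} (hs0 : s0 ∈ naturalSpace ν) {S : Fin N × Fin M → ℝ}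
    (hS : ∀ ij, S ij ∈ naturalSpace ν) :
    matrixLaw ν S = (nullLaw ν s0 N M).withDensity fun Y => ENNReal.ofReal (likelihood ν s0 S Y) := by
  have := isProbabilityMeasure_expLaw hs0
  unfold nullLaw
  conv_lhs => rw [matrixLaw]; arg 1; ext ij; rw [expLaw_eq_withDensity ν s0 (S ij)]
  rw [pi_withDensity (fun _ => expLaw ν s0)
    (fun _ _ => (Real.exp_pos _).le)]
  · simp only [matrixLaw, likelihood, ← Real.exp_sum, Finset.sum_sub_distrib]
  · intro ij
    simp only [Real.exp_sub]
    refine Integrable.div_const (integrable_exp_expLaw ?_) _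
    simpa using hS ij

lemma integral_matrixLaw {s0 : ℝ} (hs0 : s0 ∈ naturalSpace ν) {S : Fin N × Fin M → ℝ}
    (hS : ∀ ij, S ij ∈ naturalSpace ν) (g : (Fin N × Fin M → ℝ) → ℝ) :
    ∫ Y, g Y ∂matrixLaw ν S = ∫ Y, likelihood ν s0 S Y * g Y ∂nullLaw ν s0 N M := by
  rw [matrixLaw_eq_withDensity hs0 hS, integral_withDensity_eq_integral_toReal_smul
    (measurable_likelihood s0 S).ennreal_ofReal (ae_of_all _ fun _ => ENNReal.ofReal_lt_top)]
  refine integral_congr_ae (ae_of_all _ fun Y => ?_)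
  simp only [likelihood, smul_eq_mul]
  rw [ENNReal.toReal_ofReal (Real.exp_pos _).le]

lemma integrable_likelihood {s0 : ℝ} (hs0 : s0 ∈ naturalSpace ν) {S : Fin N × Fin M → ℝ}
    (hS : ∀ ij, S ij ∈ naturalSpace ν) :
    Integrable (likelihood ν s0 S) (nullLaw ν s0 N M) := by
  unfold likelihood nullLaw
  simp only [Real.exp_sub]
  refine Integrable.div_const (integrable_exp_matrixLaw (fun _ => hs0) fun ij => ?_) _
  simpa using hS ij

section
variable {ν : Measure ℝ} [NeZero ν] {N M : ℕ}

/-- The form used for Chernoff bounds: only the entries in `C` are tilted, so only these must remain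
in the natural parameter space after the shift. -/
lemma exp_sum_matrixLaw {S : Fin N × Fin M → ℝ} (hS : ∀ ij, S ij ∈ naturalSpace ν)
    (C : Finset (Fin N × Fin M)) {c : ℝ} (hc : ∀ ij ∈ C, S ij + c ∈ naturalSpace ν) :
    Integrable (fun Y => Real.exp (c * ∑ ij ∈ C, Y ij)) (matrixLaw ν S) ∧
      ∫ Y, Real.exp (c * ∑ ij ∈ C, Y ij) ∂matrixLaw ν S =
        Real.exp (∑ ij ∈ C, (cumulant ν (S ij + c) - cumulant ν (S ij))) := by
  classical
  set h : Fin N × Fin M → ℝ := fun ij => if ij ∈ C then c else 0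
  have hSh : ∀ ij, S ij + h ij ∈ naturalSpace ν := by
    intro ij
    by_cases hij : ij ∈ C
    · simpa [h, hij] using hc ij hij
    · simpa [h, hij] using hS ij
  have e1 : ∀ Y : Fin N × Fin M → ℝ, c * ∑ ij ∈ C, Y ij = ∑ ij, h ij * Y ij := by
    intro Y
    simp [h, Finset.mul_sum, ite_mul, Finset.sum_ite_mem]
  have e2 : ∑ ij ∈ C, (cumulant ν (S ij + c) - cumulant ν (S ij)) =
      ∑ ij, (cumulant ν (S ij + h ij) - cumulant ν (S ij)) := by
    rw [← Finset.sum_subset (Finset.subset_univ C)]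
    · exact Finset.sum_congr rfl fun ij hij => by simp [h, hij]
    · intro ij _ hij; simp [h, hij]
  simp only [e1, e2]
  exact ⟨integrable_exp_matrixLaw hS hSh, integral_exp_matrixLaw hS hSh⟩

omit [NeZero ν] in
lemma typeTwoError_nonneg {ψ : (Fin N × Fin M → ℝ) → ℝ} (h : ∀ Y, ψ Y ≤ 1)
    (S : Fin N × Fin M → ℝ) : 0 ≤ typeTwoError ν ψ S :=
  integral_nonneg fun Y => sub_nonneg.2 (h Y)

omit [NeZero ν] in
lemma maxTypeTwoError_nonneg {D : Set ℝ} {s0 a : ℝ} {n m : ℕ} {ψ : (Fin N × Fin M → ℝ) → ℝ}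
    (h : ∀ Y, ψ Y ≤ 1) : 0 ≤ maxTypeTwoError ν D s0 n m a ψ :=
  Real.iSup_nonneg fun S => typeTwoError_nonneg h S.1

end

/-! ### Pointwise exponential bounds for the tests -/

section
variable {N M : ℕ}

lemma linTest_mem (H : ℝ) (Y : Fin N × Fin M → ℝ) : 0 ≤ linTest H Y ∧ linTest H Y ≤ 1 := by
  unfold linTest; split_ifs <;> norm_num

lemma scanTest_mem (n m : ℕ) (T : ℝ) (Y : Fin N × Fin M → ℝ) :
    0 ≤ scanTest n m T Y ∧ scanTest n m T Y ≤ 1 := by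
  unfold scanTest; split_ifs <;> norm_num

lemma combinedTest_mem (δ H : ℝ) (n m : ℕ) (Y : Fin N × Fin M → ℝ) :
    0 ≤ combinedTest δ H N M n m Y ∧ combinedTest δ H N M n m Y ≤ 1 :=
  ⟨le_max_of_le_left (linTest_mem H Y).1, max_le (linTest_mem H Y).2 (scanTest_mem _ _ _ Y).2⟩

/-- Exponential Markov inequality before integration. Tilt one suffices for the linear statistic
because `H` and its distance from the shifted mean tend to infinity. -/
lemma linTest_le_exp (H : ℝ) (Y : Fin N × Fin M → ℝ) :
    linTest H Y ≤ Real.exp (linStat Y - H) := by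
  unfold linTest
  split_ifs with h
  · exact Real.one_le_exp (by linarith)
  · positivity

lemma one_sub_linTest_le_exp (H : ℝ) (Y : Fin N × Fin M → ℝ) :
    1 - linTest H Y ≤ Real.exp (H - linStat Y) := by
  unfold linTest
  split_ifs with h
  · rw [sub_self]; positivity
  · rw [sub_zero]; exact Real.one_le_exp (by linarith)

lemma submatrices_nonempty {n m : ℕ} (hn : n ≤ N) (hm : m ≤ M) :
    (submatrices N M n m).Nonempty := by
  obtain ⟨A, -, hA⟩ := Finset.exists_subset_card_eq (s := (Finset.univ : Finset (Fin N)))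
    (by simpa using hn)
  obtain ⟨B, -, hB⟩ := Finset.exists_subset_card_eq (s := (Finset.univ : Finset (Fin M)))
    (by simpa using hm)
  exact ⟨A ×ˢ B, A, B, hA, hB, rfl⟩

lemma card_of_mem_submatrices {n m : ℕ} {C : Finset (Fin N × Fin M)}
    (hC : C ∈ submatrices N M n m) : C.card = n * m := by
  obtain ⟨A, B, rfl, rfl, rfl⟩ := hC
  exact Finset.card_product A B

lemma le_scanStat {n m : ℕ} {C : Finset (Fin N × Fin M)} (hC : C ∈ submatrices N M n m)
    (Y : Fin N × Fin M → ℝ) : (∑ ij ∈ C, Y ij) / √((n : ℝ) * m) ≤ scanStat n m Y :=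
  le_ciSup (f := fun C : submatrices N M n m => (∑ ij ∈ C.1, Y ij) / √((n : ℝ) * m))
    (Set.finite_range _).bddAbove ⟨C, hC⟩

/-- Union bound combined with the exponential Markov inequality. The tilt `r` is left free since the
number of submatrices has to be beaten, which takes a tilt of the order of `T`. -/
lemma scanTest_le_sum_exp {n m : ℕ} (hn : n ≤ N) (hm : m ≤ M) {r : ℝ} (hr : 0 ≤ r) (T : ℝ)
    (Y : Fin N × Fin M → ℝ) :
    scanTest n m T Y ≤ ∑ A ∈ (Finset.univ : Finset (Fin N)).powersetCard n,
      ∑ B ∈ (Finset.univ : Finset (Fin M)).powersetCard m,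
        Real.exp (r * ((∑ ij ∈ A ×ˢ B, Y ij) / √((n : ℝ) * m) - T)) := by
  unfold scanTest
  split_ifs with h
  · have : Nonempty (submatrices N M n m) := (submatrices_nonempty hn hm).to_subtype
    obtain ⟨⟨C, A, B, hA, hB, rfl⟩, hC⟩ := exists_lt_of_lt_ciSup h
    have hA' : A ∈ (Finset.univ : Finset (Fin N)).powersetCard n := by simp [hA]
    have hB' : B ∈ (Finset.univ : Finset (Fin M)).powersetCard m := by simp [hB]
    refine le_trans ?_ (Finset.single_le_sum (fun A _ => Finset.sum_nonneg fun B _ =>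
      (Real.exp_pos _).le) hA')
    refine le_trans ?_ (Finset.single_le_sum (fun B _ => (Real.exp_pos _).le) hB')
    exact Real.one_le_exp (mul_nonneg hr (sub_nonneg.2 hC.le))
  · positivity

lemma one_sub_scanTest_le_exp {n m : ℕ} {C : Finset (Fin N × Fin M)}
    (hC : C ∈ submatrices N M n m) (T : ℝ) (Y : Fin N × Fin M → ℝ) :
    1 - scanTest n m T Y ≤ Real.exp (T - (∑ ij ∈ C, Y ij) / √((n : ℝ) * m)) := by
  unfold scanTest
  split_ifs with h
  · rw [sub_self]; positivity
  · rw [sub_zero]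
    have := le_scanStat hC Y
    exact Real.one_le_exp (by linarith)

end

/-! ### Chernoff bounds for the errors of the combined test -/

section
variable {ν : Measure ℝ} [NeZero ν] {N M n m : ℕ} {s0 K ρ : ℝ}

/-- The tilts are 1/√(NM) on all entries and T/√(nm) on each submatrix. Since A'(s0) = 0, only the
quadratic terms remain, and summed over the entries they give K/2 and KT²/2; the latter is set
against -T² from the threshold. -/
lemma typeOneError_combinedTest_le (hA1 : deriv (cumulant ν) s0 = 0)
    (hQ : QuadraticBound ν s0 K ρ) (hn : n ≤ N) (hm : m ≤ M) (hn0 : 0 < n) (hm0 : 0 < m)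
    {δ H : ℝ} (h1 : 1 / √((N : ℝ) * M) ≤ ρ) (h2 : scanThreshold δ N M n m / √((n : ℝ) * m) ≤ ρ) :
    typeOneError ν s0 (combinedTest δ H N M n m) ≤ Real.exp (K / 2 - H) +
      (N.choose n : ℝ) * (M.choose m : ℝ) *
        Real.exp (-(1 - K / 2) * scanThreshold δ N M n m ^ 2) := by
  have hN : (0 : ℝ) < N := by exact_mod_cast hn0.trans_le hn
  have hM : (0 : ℝ) < M := by exact_mod_cast hm0.trans_le hm
  have hn' : (0 : ℝ) < n := by exact_mod_cast hn0
  have hm' : (0 : ℝ) < m := by exact_mod_cast hm0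
  set T := scanThreshold δ N M n m with hT
  have hT0 : 0 ≤ T := Real.sqrt_nonneg _
  set w := √((N : ℝ) * M) with hw
  have hw0 : 0 < w := Real.sqrt_pos.2 (by positivity)
  have hw2 : w ^ 2 = (N : ℝ) * M := Real.sq_sqrt (by positivity)
  set v := √((n : ℝ) * m) with hv
  have hv0 : 0 < v := Real.sqrt_pos.2 (by positivity)
  have hv2 : v ^ 2 = (n : ℝ) * m := Real.sq_sqrt (by positivity)
  have hρ : 0 ≤ ρ := le_trans (by positivity) h1
  have hcent : s0 ∈ Set.Icc (s0 - ρ) (s0 + ρ) := ⟨by linarith, by linarith⟩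
  have hnat := (hQ s0 hcent).1
  have hmem : ∀ c : ℝ, 0 ≤ c → c ≤ ρ → s0 + c ∈ Set.Icc (s0 - ρ) (s0 + ρ) :=
    fun c h0 hc => ⟨by linarith, by linarith⟩
  have hquad : ∀ c : ℝ, 0 ≤ c → c ≤ ρ → cumulant ν (s0 + c) - cumulant ν s0 ≤ K / 2 * c ^ 2 := by
    intro c h0 hc
    have := (hQ s0 hcent).2 _ (hmem c h0 hc)
    rwa [hA1, mul_zero, zero_add, add_sub_cancel_left] at this
  have hS : ∀ ij : Fin N × Fin M, (fun _ : Fin N × Fin M => s0) ij ∈ naturalSpace ν :=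
    fun _ => hnat
  have hlin := exp_sum_matrixLaw hS Finset.univ (c := 1 / w)
    (fun ij _ => (hQ _ (hmem _ (by positivity) h1)).1)
  have hscan := fun C => exp_sum_matrixLaw hS C (c := T / v)
    (fun ij _ => (hQ _ (hmem _ (by positivity) h2)).1)
  have e1 : ∀ Y : Fin N × Fin M → ℝ, Real.exp (linStat Y - H) =
      Real.exp (1 / w * ∑ ij, Y ij) * Real.exp (-H) := by
    intro Y
    rw [← Real.exp_add, linStat]
    congr 1
    rw [← hw]; ring
  have e2 : ∀ (C : Finset (Fin N × Fin M)) (Y : Fin N × Fin M → ℝ),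
      Real.exp (T * ((∑ ij ∈ C, Y ij) / v - T)) =
      Real.exp (T / v * ∑ ij ∈ C, Y ij) * Real.exp (-T ^ 2) := by
    intro C Y
    rw [← Real.exp_add]
    congr 1
    ring
  have i1 : Integrable (fun Y : Fin N × Fin M → ℝ => Real.exp (linStat Y - H))
      (nullLaw ν s0 N M) := by
    simp only [e1]
    exact hlin.1.mul_const _
  have i2 : ∀ C : Finset (Fin N × Fin M), Integrable (fun Y : Fin N × Fin M → ℝ =>
      Real.exp (T * ((∑ ij ∈ C, Y ij) / v - T))) (nullLaw ν s0 N M) := by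
    intro C
    simp only [e2]
    exact (hscan C).1.mul_const _
  have i3 := integrable_finsetSum ((Finset.univ : Finset (Fin N)).powersetCard n) fun A _ =>
    integrable_finsetSum ((Finset.univ : Finset (Fin M)).powersetCard m) fun B _ => i2 (A ×ˢ B)
  refine (integral_mono_of_nonneg (ae_of_all _ fun Y => (combinedTest_mem δ H n m Y).1)
    (i1.add i3) (ae_of_all _ fun Y => ?_)).trans ?_
  · refine (max_le_add_of_nonneg (linTest_mem H Y).1 (scanTest_mem _ _ _ Y).1).trans ?_
    exact add_le_add (linTest_le_exp H Y) (scanTest_le_sum_exp hn hm hT0 T Y)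
  · simp only [Pi.add_apply]
    rw [integral_add i1 i3]
    refine add_le_add ?_ ?_
    · simp only [e1, integral_mul_const]
      unfold nullLaw
      rw [hlin.2, ← Real.exp_add]
      refine Real.exp_le_exp.2 ?_
      simp only [Finset.sum_const, Finset.card_univ, Fintype.card_prod, Fintype.card_fin,
        nsmul_eq_mul, Nat.cast_mul]
      have h3 := mul_le_mul_of_nonneg_left (hquad _ (by positivity) h1) (sq_nonneg w)
      rw [hw2] at h3
      have h4 : (N : ℝ) * M * (K / 2 * (1 / w) ^ 2) = K / 2 := by
        rw [← hw2]; field_simp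
      linarith
    · rw [integral_finsetSum _ fun A _ =>
        integrable_finsetSum ((Finset.univ : Finset (Fin M)).powersetCard m) fun B _ =>
          i2 (A ×ˢ B)]
      have hbound : ∀ A ∈ (Finset.univ : Finset (Fin N)).powersetCard n,
          ∫ Y, ∑ B ∈ (Finset.univ : Finset (Fin M)).powersetCard m,
            Real.exp (T * ((∑ ij ∈ A ×ˢ B, Y ij) / v - T)) ∂nullLaw ν s0 N M ≤
          (M.choose m : ℝ) * Real.exp (-(1 - K / 2) * T ^ 2) := by
        intro A hA
        rw [integral_finsetSum _ fun B _ => i2 (A ×ˢ B)]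
        refine (Finset.sum_le_card_nsmul _ _ (Real.exp (-(1 - K / 2) * T ^ 2)) ?_).trans ?_
        · intro B hB
          simp only [e2, integral_mul_const]
          unfold nullLaw
          rw [(hscan _).2, ← Real.exp_add]
          refine Real.exp_le_exp.2 ?_
          simp only [Finset.sum_const, Finset.card_product, nsmul_eq_mul, Nat.cast_mul,
            (Finset.mem_powersetCard.1 hA).2, (Finset.mem_powersetCard.1 hB).2]
          have h3 := mul_le_mul_of_nonneg_left (hquad _ (by positivity) h2) (sq_nonneg v)
          rw [hv2] at h3
          have h4 : (n : ℝ) * m * (K / 2 * (T / v) ^ 2) = K / 2 * T ^ 2 := by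
            rw [← hv2]; field_simp
          linarith
        · rw [Finset.card_powersetCard, Finset.card_univ, Fintype.card_fin, nsmul_eq_mul]
      refine (Finset.sum_le_card_nsmul _ _ _ hbound).trans ?_
      rw [Finset.card_powersetCard, Finset.card_univ, Fintype.card_fin, nsmul_eq_mul, mul_assoc]

/-- The scan statistic is at least its value at the planted submatrix, to which the tilt -1/√(nm) is
applied. By `cumulant_sub_le` each planted entry does no worse than one with parameter `b`, where
the quadratic bound is available; `b` is kept below `s0 + a` so that signals outside the range of
that bound are covered. -/
lemma typeTwoError_scan_le {D : Set ℝ} (hD : D ⊆ naturalSpace ν)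
    (hQ : QuadraticBound ν s0 K ρ) (hn0 : 0 < n) (hm0 : 0 < m)
    {a b δ H : ℝ} (hb : b ∈ Set.Icc s0 (s0 + ρ)) (hba : b ≤ s0 + a)
    (h1 : 1 / √((n : ℝ) * m) ≤ ρ) {S : Fin N × Fin M → ℝ} (hS : S ∈ alternative D s0 N M n m a) :
    typeTwoError ν (combinedTest δ H N M n m) S ≤
      Real.exp (scanThreshold δ N M n m - √((n : ℝ) * m) * deriv (cumulant ν) b + K / 2) := by
  obtain ⟨hSD, C, hC, -, hSa⟩ := hS
  have hn' : (0 : ℝ) < n := by exact_mod_cast hn0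
  have hm' : (0 : ℝ) < m := by exact_mod_cast hm0
  set T := scanThreshold δ N M n m with hT
  set v := √((n : ℝ) * m) with hv
  have hv0 : 0 < v := Real.sqrt_pos.2 (by positivity)
  have hv2 : v ^ 2 = (n : ℝ) * m := Real.sq_sqrt (by positivity)
  have hinv : 0 < 1 / v := by positivity
  have hb1 : b ∈ Set.Icc (s0 - ρ) (s0 + ρ) := ⟨by linarith [hb.1], hb.2⟩
  have hb2 : b - 1 / v ∈ Set.Icc (s0 - ρ) (s0 + ρ) := ⟨by linarith [hb.1], by linarith [hb.2]⟩
  have hSn : ∀ ij, S ij ∈ naturalSpace ν := fun ij => hD (hSD ij)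
  have hstep : ∀ ij ∈ C, S ij - 1 / v ∈ naturalSpace ν ∧ cumulant ν (S ij - 1 / v) -
      cumulant ν (S ij) ≤ cumulant ν (b - 1 / v) - cumulant ν b := fun ij hij =>
    cumulant_sub_le hinv.le (by linarith [hSa ij hij]) (hQ _ hb2).1 (hSn ij)
  obtain ⟨hi, he⟩ := exp_sum_matrixLaw hSn C (c := -(1 / v)) (fun ij hij => by
    rw [← sub_eq_add_neg]; exact (hstep ij hij).1)
  have e1 : ∀ Y : Fin N × Fin M → ℝ, Real.exp (T - (∑ ij ∈ C, Y ij) / v) =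
      Real.exp (-(1 / v) * ∑ ij ∈ C, Y ij) * Real.exp T := by
    intro Y
    rw [← Real.exp_add]
    congr 1
    ring
  refine (integral_mono_of_nonneg (ae_of_all _ fun Y =>
    sub_nonneg.2 (combinedTest_mem δ H n m Y).2) (hi.mul_const (Real.exp T))
    (ae_of_all _ fun Y => ?_)).trans ?_
  · simp only [← e1]
    refine le_trans ?_ (one_sub_scanTest_le_exp hC T Y)
    exact sub_le_sub_left (le_max_right _ _) _
  · rw [integral_mul_const, he, ← Real.exp_add]
    refine Real.exp_le_exp.2 ?_
    have h3 : ∑ ij ∈ C, (cumulant ν (S ij + -(1 / v)) - cumulant ν (S ij)) ≤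
        (n : ℝ) * m * (cumulant ν (b - 1 / v) - cumulant ν b) := by
      refine (Finset.sum_le_card_nsmul _ _ (cumulant ν (b - 1 / v) - cumulant ν b)
        fun ij hij => ?_).trans ?_
      · rw [← sub_eq_add_neg]; exact (hstep ij hij).2
      · rw [card_of_mem_submatrices hC, nsmul_eq_mul, Nat.cast_mul]
    have h4 := mul_le_mul_of_nonneg_left ((hQ _ hb1).2 _ hb2) (sq_nonneg v)
    rw [hv2] at h4
    have h5 : (n : ℝ) * m * ((b - 1 / v - b) * deriv (cumulant ν) b +
        K / 2 * (b - 1 / v - b) ^ 2) = -(v * deriv (cumulant ν) b) + K / 2 := by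
      rw [← hv2]; field_simp; ring
    linarith

/-- Now all entries receive the tilt -1/√(NM). Off the planted submatrix the linear term vanishes
since A'(s0) = 0, and the quadratic terms of all NM entries add up to K/2. -/
lemma typeTwoError_lin_le {D : Set ℝ} (hD : D ⊆ naturalSpace ν)
    (hA1 : deriv (cumulant ν) s0 = 0)
    (hQ : QuadraticBound ν s0 K ρ) (hN0 : 0 < N) (hM0 : 0 < M)
    {a b δ H : ℝ} (hb : b ∈ Set.Icc s0 (s0 + ρ)) (hba : b ≤ s0 + a)
    (h1 : 1 / √((N : ℝ) * M) ≤ ρ) {S : Fin N × Fin M → ℝ} (hS : S ∈ alternative D s0 N M n m a) :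
    typeTwoError ν (combinedTest δ H N M n m) S ≤
      Real.exp (H - (n : ℝ) * m / √((N : ℝ) * M) * deriv (cumulant ν) b + K / 2) := by
  obtain ⟨hSD, C, hC, hS0, hSa⟩ := hS
  have hN : (0 : ℝ) < N := by exact_mod_cast hN0
  have hM : (0 : ℝ) < M := by exact_mod_cast hM0
  set w := √((N : ℝ) * M) with hw
  have hw0 : 0 < w := Real.sqrt_pos.2 (by positivity)
  have hw2 : w ^ 2 = (N : ℝ) * M := Real.sq_sqrt (by positivity)
  have hinv : 0 < 1 / w := by positivity
  have hρ : 0 < ρ := by linarith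
  have hb1 : b ∈ Set.Icc (s0 - ρ) (s0 + ρ) := ⟨by linarith [hb.1], hb.2⟩
  have hb2 : b - 1 / w ∈ Set.Icc (s0 - ρ) (s0 + ρ) := ⟨by linarith [hb.1], by linarith [hb.2]⟩
  have hc1 : s0 ∈ Set.Icc (s0 - ρ) (s0 + ρ) := ⟨by linarith, by linarith⟩
  have hc2 : s0 - 1 / w ∈ Set.Icc (s0 - ρ) (s0 + ρ) := ⟨by linarith, by linarith⟩
  have hSn : ∀ ij, S ij ∈ naturalSpace ν := fun ij => hD (hSD ij)
  have hstep : ∀ ij, S ij - 1 / w ∈ naturalSpace ν ∧ cumulant ν (S ij - 1 / w) -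
      cumulant ν (S ij) ≤ K / 2 * (1 / w) ^ 2 +
        if ij ∈ C then -(1 / w * deriv (cumulant ν) b) else 0 := by
    intro ij
    split_ifs with hij
    · obtain ⟨h2, h3⟩ := cumulant_sub_le hinv.le (show b ≤ S ij by linarith [hSa ij hij])
        (hQ _ hb2).1 (hSn ij)
      have h4 := (hQ _ hb1).2 _ hb2
      have h5 : b - 1 / w - b = -(1 / w) := by ring
      rw [h5] at h4
      exact ⟨h2, by linarith [neg_sq (1 / w)]⟩
    · rw [hS0 ij hij]
      have h4 := (hQ _ hc1).2 _ hc2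
      have h5 : s0 - 1 / w - s0 = -(1 / w) := by ring
      rw [hA1, h5] at h4
      exact ⟨(hQ _ hc2).1, by linarith [neg_sq (1 / w)]⟩
  obtain ⟨hi, he⟩ := exp_sum_matrixLaw hSn Finset.univ (c := -(1 / w)) (fun ij _ => by
    rw [← sub_eq_add_neg]; exact (hstep ij).1)
  have e1 : ∀ Y : Fin N × Fin M → ℝ, Real.exp (H - linStat Y) =
      Real.exp (-(1 / w) * ∑ ij, Y ij) * Real.exp H := by
    intro Y
    rw [← Real.exp_add, linStat]
    congr 1
    rw [← hw]; ring
  refine (integral_mono_of_nonneg (ae_of_all _ fun Y =>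
    sub_nonneg.2 (combinedTest_mem δ H n m Y).2) (hi.mul_const (Real.exp H))
    (ae_of_all _ fun Y => ?_)).trans ?_
  · simp only [← e1]
    refine le_trans ?_ (one_sub_linTest_le_exp H Y)
    exact sub_le_sub_left (le_max_left _ _) _
  · rw [integral_mul_const, he, ← Real.exp_add]
    refine Real.exp_le_exp.2 ?_
    have h3 : ∑ ij, (cumulant ν (S ij + -(1 / w)) - cumulant ν (S ij)) ≤
        K / 2 - (n : ℝ) * m / w * deriv (cumulant ν) b := by
      simp only [← sub_eq_add_neg]
      refine (Finset.sum_le_sum fun ij _ => (hstep ij).2).trans (le_of_eq ?_)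
      rw [Finset.sum_add_distrib, Finset.sum_ite_mem, Finset.univ_inter]
      simp only [Finset.sum_const, Finset.card_univ, Fintype.card_prod, Fintype.card_fin,
        nsmul_eq_mul, Nat.cast_mul, card_of_mem_submatrices hC]
      rw [← hw2]; field_simp; ring
    linarith

end

/-! ### Entropy of the collection of submatrices -/

/-- Stirling's upper bound `log (N.choose n) ≤ n (log (N / n) + 1)`. -/
lemma log_choose_le {N n : ℕ} (hn : 0 < n) (hnN : n ≤ N) :
    Real.log (N.choose n) ≤ n * (Real.log ((n : ℝ) / N)⁻¹ + 1) := by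
  have hn' : (0 : ℝ) < n := by exact_mod_cast hn
  have hN' : (0 : ℝ) < N := by exact_mod_cast hn.trans_le hnN
  have hC : (0 : ℝ) < N.choose n := by exact_mod_cast Nat.choose_pos hnN
  have hf : (0 : ℝ) < n.factorial := by exact_mod_cast n.factorial_pos
  have h1 : (N.choose n : ℝ) ≤ (N : ℝ) ^ n / n.factorial := Nat.choose_le_pow_div n N
  have h2 := Real.pow_div_factorial_le_exp (n : ℝ) hn'.le n
  rw [Real.log_le_iff_le_exp hC]
  have h3 : Real.exp (n * (Real.log ((n : ℝ) / N)⁻¹ + 1)) = ((N : ℝ) / n) ^ n * Real.exp n := by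
    rw [mul_add, mul_one, Real.exp_add, Real.exp_nat_mul, inv_div, Real.exp_log (by positivity)]
  rw [h3]
  calc (N.choose n : ℝ) ≤ (N : ℝ) ^ n / n.factorial := h1
    _ = ((N : ℝ) / n) ^ n * ((n : ℝ) ^ n / n.factorial) := by
        rw [div_pow]; field_simp
    _ ≤ _ := by gcongr

/-- From C(N,n) = (N/n) C(N-1,n-1). This crude bound serves only to make the number of submatrices
tend to infinity. -/
lemma inv_le_choose {N n : ℕ} (hn : 0 < n) (hnN : n ≤ N) :
    ((n : ℝ) / N)⁻¹ ≤ N.choose n := by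
  obtain ⟨k, rfl⟩ := Nat.exists_eq_succ_of_ne_zero hn.ne'
  obtain ⟨K, rfl⟩ := Nat.exists_eq_succ_of_ne_zero (hn.trans_le hnN).ne'
  have h := Nat.add_one_mul_choose_eq K k
  have h1 : 1 ≤ K.choose k := Nat.choose_pos (by omega)
  rw [inv_div, div_le_iff₀ (by positivity)]
  have : K + 1 ≤ (K + 1).choose (k + 1) * (k + 1) := by rw [← h]; nlinarith
  exact_mod_cast this

/-- The asymptotic regime of sparse `n × m` submatrices of an `N × M` matrix. -/
structure SparseRegime {ι : Type*} (l : Filter ι) (N M n m : ι → ℕ) (p q : ι → ℝ) : Prop where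
  hp : ∀ i, p i = (n i : ℝ) / N i
  hq : ∀ i, q i = (m i : ℝ) / M i
  hN : Tendsto N l atTop
  hM : Tendsto M l atTop
  hn : Tendsto n l atTop
  hm : Tendsto m l atTop
  hp0 : Tendsto p l (𝓝 0)
  hq0 : Tendsto q l (𝓝 0)
  htend : Tendsto (fun i => Real.log (p i)⁻¹ / m i + Real.log (q i)⁻¹ / n i) l (𝓝 0)

/-- The quantity `n log (1 / p) + m log (1 / q)`, the leading term of the log-cardinality of the
collection of submatrices. -/
noncomputable def entropy (n m : ℕ) (p q : ℝ) : ℝ := n * Real.log p⁻¹ + m * Real.log q⁻¹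

namespace SparseRegime

variable {ι : Type*} {l : Filter ι} {N M n m : ι → ℕ} {p q : ι → ℝ}

lemma swap (h : SparseRegime l N M n m p q) : SparseRegime l M N m n q p :=
  ⟨h.hq, h.hp, h.hM, h.hN, h.hm, h.hn, h.hq0, h.hp0, by simpa only [add_comm] using h.htend⟩

variable (h : SparseRegime l N M n m p q)
include h

lemma eventually_pos : ∀ᶠ i in l, 0 < n i ∧ n i ≤ N i ∧ 0 < p i ∧ p i < 1 := by
  filter_upwards [h.hn.eventually_gt_atTop 0, h.hN.eventually_gt_atTop 0,
    h.hp0.eventually_lt_const one_pos] with i h1 h2 h3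
  have h1' : (0 : ℝ) < n i := by exact_mod_cast h1
  have h2' : (0 : ℝ) < N i := by exact_mod_cast h2
  refine ⟨h1, ?_, ?_, h3⟩
  · rw [h.hp, div_lt_one h2'] at h3
    exact_mod_cast h3.le
  · rw [h.hp]; positivity

lemma tendsto_inv : Tendsto (fun i => (p i)⁻¹) l atTop := by
  refine Tendsto.inv_tendsto_nhdsGT_zero ?_
  exact tendsto_nhdsWithin_iff.2 ⟨h.hp0, h.eventually_pos.mono fun i hi => hi.2.2.1⟩

lemma tendsto_log : Tendsto (fun i => Real.log (p i)⁻¹) l atTop :=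
  Real.tendsto_log_atTop.comp h.tendsto_inv

lemma tendsto_cast : Tendsto (fun i => (n i : ℝ)) l atTop :=
  tendsto_natCast_atTop_atTop.comp h.hn

lemma tendsto_entropy : Tendsto (fun i => entropy (n i) (m i) (p i) (q i)) l atTop :=
  (h.tendsto_cast.atTop_mul_atTop₀ h.tendsto_log).atTop_add_atTop
    (h.swap.tendsto_cast.atTop_mul_atTop₀ h.swap.tendsto_log)

lemma tendsto_entropy_div :
    Tendsto (fun i => entropy (n i) (m i) (p i) (q i) / ((n i : ℝ) * m i)) l (𝓝 0) := by
  refine h.htend.congr' ?_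
  filter_upwards [h.eventually_pos, h.swap.eventually_pos] with i h1 h2
  have h1' : (0 : ℝ) < n i := by exact_mod_cast h1.1
  have h2' : (0 : ℝ) < m i := by exact_mod_cast h2.1
  rw [entropy]
  field_simp

lemma tendsto_sqrt_mul : Tendsto (fun i => √((n i : ℝ) * m i)) l atTop :=
  Real.tendsto_sqrt_atTop.comp (h.tendsto_cast.atTop_mul_atTop₀ h.swap.tendsto_cast)

lemma tendsto_sqrt_mul_total : Tendsto (fun i => √((N i : ℝ) * M i)) l atTop :=
  Real.tendsto_sqrt_atTop.comp ((tendsto_natCast_atTop_atTop.comp h.hN).atTop_mul_atTop₀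
    (tendsto_natCast_atTop_atTop.comp h.hM))

/-- The `+ 1` in `log_choose_le` is absorbed into ε because log(1/p) and log(1/q) tend to infinity.
-/
lemma log_card_le {ε : ℝ} (hε : 0 < ε) : ∀ᶠ i in l,
    Real.log (((N i).choose (n i) : ℝ) * ((M i).choose (m i) : ℝ)) ≤
      (1 + ε) * entropy (n i) (m i) (p i) (q i) := by
  filter_upwards [h.eventually_pos, h.swap.eventually_pos,
    h.tendsto_log.eventually_ge_atTop ε⁻¹, h.swap.tendsto_log.eventually_ge_atTop ε⁻¹]
    with i h1 h2 h3 h4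
  have hC1 : ((N i).choose (n i) : ℝ) ≠ 0 := by exact_mod_cast (Nat.choose_pos h1.2.1).ne'
  have hC2 : ((M i).choose (m i) : ℝ) ≠ 0 := by exact_mod_cast (Nat.choose_pos h2.2.1).ne'
  rw [Real.log_mul hC1 hC2]
  have h5 := log_choose_le h1.1 h1.2.1
  have h6 := log_choose_le h2.1 h2.2.1
  rw [← h.hp] at h5
  rw [← h.hq] at h6
  have h7 : (n i : ℝ) * 1 ≤ n i * (ε * Real.log (p i)⁻¹) := by
    gcongr; rwa [inv_le_iff_one_le_mul₀' hε] at h3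
  have h8 : (m i : ℝ) * 1 ≤ m i * (ε * Real.log (q i)⁻¹) := by
    gcongr; rwa [inv_le_iff_one_le_mul₀' hε] at h4
  rw [entropy]
  nlinarith

lemma tendsto_log_card : Tendsto (fun i =>
    Real.log (((N i).choose (n i) : ℝ) * ((M i).choose (m i) : ℝ))) l atTop := by
  refine Real.tendsto_log_atTop.comp (tendsto_atTop_mono' l ?_
    (h.tendsto_inv.atTop_mul_atTop₀ h.swap.tendsto_inv))
  filter_upwards [h.eventually_pos, h.swap.eventually_pos] with i h1 h2
  have h5 := inv_le_choose h1.1 h1.2.1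
  have h6 := inv_le_choose h2.1 h2.2.1
  rw [← h.hp] at h5
  rw [← h.hq] at h6
  have := h1.2.2.1
  have := h2.2.2.1
  gcongr

lemma scanThreshold_sq {δ : ℝ} (hδ : 0 < δ) : ∀ᶠ i in l,
    scanThreshold δ (N i) (M i) (n i) (m i) ^ 2 =
      (2 + δ) * Real.log (((N i).choose (n i) : ℝ) * ((M i).choose (m i) : ℝ)) := by
  filter_upwards [h.tendsto_log_card.eventually_ge_atTop 0] with i hi
  exact Real.sq_sqrt (by positivity)

lemma tendsto_scanThreshold_div {δ : ℝ} (hδ : 0 < δ) :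
    Tendsto (fun i => scanThreshold δ (N i) (M i) (n i) (m i) / √((n i : ℝ) * m i)) l (𝓝 0) := by
  have h1 : Tendsto (fun i => √((2 + δ) * (2 * (entropy (n i) (m i) (p i) (q i) /
      ((n i : ℝ) * m i))))) l (𝓝 0) := by
    have := ((h.tendsto_entropy_div.const_mul 2).const_mul (2 + δ)).sqrt
    simpa using this
  refine squeeze_zero' (Eventually.of_forall fun i => ?_) ?_ h1
  · exact div_nonneg (Real.sqrt_nonneg _) (Real.sqrt_nonneg _)
  filter_upwards [h.log_card_le one_pos, h.eventually_pos, h.swap.eventually_pos] with i hi h3 h4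
  have h3' : (0 : ℝ) < n i := by exact_mod_cast h3.1
  have h4' : (0 : ℝ) < m i := by exact_mod_cast h4.1
  rw [scanThreshold, ← Real.sqrt_div' _ (by positivity)]
  refine Real.sqrt_le_sqrt ?_
  rw [mul_div_assoc, ← mul_div_assoc 2]
  gcongr
  linarith

end SparseRegime

/-! ### Upper bounds: limits of the testing errors -/

section
variable {ν : Measure ℝ} {s0 : ℝ}
  {ι : Type*} {l : Filter ι} {N M n m : ι → ℕ} {p q : ι → ℝ}

lemma tendsto_typeOneError_combinedTest [NeZero ν] (h : SparseRegime l N M n m p q)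
    (hs0 : s0 ∈ interior (naturalSpace ν))
    (hA1 : deriv (cumulant ν) s0 = 0) (hA2 : iteratedDeriv 2 (cumulant ν) s0 = 1)
    {δ : ℝ} (hδ : 0 < δ) {H : ι → ℝ} (hH : Tendsto H l atTop) :
    Tendsto (fun i => typeOneError ν s0 (combinedTest δ (H i) (N i) (M i) (n i) (m i))) l
      (𝓝 0) := by
  -- This K makes (1 - K/2)(2 + δ) = 1 + δ/4, so that the union bound leaves G^(-δ/4), where G is
  -- the number of submatrices.
  set K : ℝ := 1 + δ / (2 * (2 + δ)) with hKdef
  have hK : 1 < K := by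
    have : 0 < δ / (2 * (2 + δ)) := by positivity
    linarith
  have hK2 : (1 - K / 2) * (2 + δ) = 1 + δ / 4 := by
    rw [hKdef]; field_simp; ring
  obtain ⟨ρ, hρ, hQ⟩ := exists_quadraticBound hs0 hA2 hK
  have t1 : Tendsto (fun i => Real.exp (K / 2 - H i)) l (𝓝 0) :=
    Real.tendsto_exp_atBot.comp (tendsto_atBot_add_const_left _ _
      (tendsto_neg_atTop_atBot.comp hH))
  have t2 : Tendsto (fun i => Real.exp (-(δ / 4 *
      Real.log (((N i).choose (n i) : ℝ) * ((M i).choose (m i) : ℝ))))) l (𝓝 0) :=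
    Real.tendsto_exp_atBot.comp (tendsto_neg_atTop_atBot.comp
      (h.tendsto_log_card.const_mul_atTop (by positivity)))
  refine squeeze_zero' (Eventually.of_forall fun i => integral_nonneg fun Y =>
    (combinedTest_mem δ (H i) (n i) (m i) Y).1) ?_ (by simpa using t1.add t2)
  have u1 : ∀ᶠ i in l, 1 / √((N i : ℝ) * M i) ≤ ρ := by
    have := h.tendsto_sqrt_mul_total.inv_tendsto_atTop
    simp only [one_div]
    exact (this.eventually_lt_const hρ).mono fun i hi => hi.le
  have u2 := (h.tendsto_scanThreshold_div hδ).eventually_lt_const hρ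
  filter_upwards [h.eventually_pos, h.swap.eventually_pos, u1, u2, h.scanThreshold_sq hδ]
    with i h1 h2 h3 h4 h5
  refine (typeOneError_combinedTest_le hA1 hQ h1.2.1 h2.2.1 h1.1 h2.1 h3 h4.le).trans
    (add_le_add_right (le_of_eq ?_) _)
  have hG : (0 : ℝ) < ((N i).choose (n i) : ℝ) * ((M i).choose (m i) : ℝ) := by
    have h6 := Nat.choose_pos h1.2.1
    have h7 := Nat.choose_pos h2.2.1
    positivity
  rw [h5, ← mul_assoc, neg_mul, hK2]
  nth_rewrite 1 [← Real.exp_log hG]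
  rw [← Real.exp_add]
  congr 1
  ring

lemma tendsto_globalError_of_le [NeZero ν] (h : SparseRegime l N M n m p q)
    (hs0 : s0 ∈ interior (naturalSpace ν))
    (hA1 : deriv (cumulant ν) s0 = 0) (hA2 : iteratedDeriv 2 (cumulant ν) s0 = 1)
    {δ : ℝ} (hδ : 0 < δ) {H : ι → ℝ} (hH : Tendsto H l atTop) {D : Set ℝ} {a e : ι → ℝ}
    (he0 : ∀ i, 0 ≤ e i) (he : Tendsto e l (𝓝 0))
    (hle : ∀ᶠ i in l, ∀ S ∈ alternative D s0 (N i) (M i) (n i) (m i) (a i),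
      typeTwoError ν (combinedTest δ (H i) (N i) (M i) (n i) (m i)) S ≤ e i) :
    Tendsto (fun i => globalError ν D s0 (n i) (m i) (a i)
      (combinedTest δ (H i) (N i) (M i) (n i) (m i))) l (𝓝 0) := by
  have h1 := tendsto_typeOneError_combinedTest h hs0 hA1 hA2 hδ hH
  have h2 : Tendsto (fun i => maxTypeTwoError ν D s0 (n i) (m i) (a i)
      (combinedTest δ (H i) (N i) (M i) (n i) (m i))) l (𝓝 0) := by
    refine squeeze_zero' (Eventually.of_forall fun i => maxTypeTwoError_nonneg fun Y =>
      (combinedTest_mem _ _ _ _ Y).2) ?_ he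
    filter_upwards [hle] with i hi
    exact Real.iSup_le (fun S => hi S.1 S.2) (he0 i)
  simpa [globalError] using h1.add h2

variable {D : Set ℝ} {a : ι → ℝ}

/-- For the second-type errors any fixed K will do, as it enters only through the factor exp(K/2).
Positivity of A'(s0 + ρ) handles the signals with a ≥ ρ. -/
lemma exists_quadraticBound_deriv_pos
    (hs0 : s0 ∈ interior (naturalSpace ν))
    (hA1 : deriv (cumulant ν) s0 = 0) (hA2 : iteratedDeriv 2 (cumulant ν) s0 = 1) :
    ∃ ρ > 0, QuadraticBound ν s0 2 ρ ∧ 0 < deriv (cumulant ν) (s0 + ρ) := by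
  obtain ⟨ρ, hρ, hQ⟩ := exists_quadraticBound hs0 hA2 (show (1 : ℝ) < 2 by norm_num)
  have h1 : ∀ᶠ r in 𝓝[>] (0 : ℝ), r ∈ Set.Ioo 0 ρ := Ioo_mem_nhdsGT hρ
  obtain ⟨r, hr, hd⟩ := (h1.and (eventually_deriv_cumulant_pos hs0 hA1 hA2)).exists
  exact ⟨r, hr.1, hQ.mono hr.2.le, hd⟩

/-- The bound for the scan test against signals that do not tend to zero. -/
lemma tendsto_exp_scanThreshold (h : SparseRegime l N M n m p q) {δ g : ℝ} (hδ : 0 < δ)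
    (hg : 0 < g) : Tendsto (fun i => Real.exp (scanThreshold δ (N i) (M i) (n i) (m i) -
      √((n i : ℝ) * m i) * g + 2 / 2)) l (𝓝 0) := by
  refine Real.tendsto_exp_atBot.comp (tendsto_atBot_add_const_right _ _ ?_)
  have h1 : Tendsto (fun i => scanThreshold δ (N i) (M i) (n i) (m i) / √((n i : ℝ) * m i) - g) l
      (𝓝 (0 - g)) := (h.tendsto_scanThreshold_div hδ).sub_const g
  refine (h.tendsto_sqrt_mul.atTop_mul_neg (by linarith) h1).congr' ?_
  filter_upwards [h.tendsto_sqrt_mul.eventually_gt_atTop 0] with i hi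
  field_simp

lemma eventually_one_div_sqrt_le (h : SparseRegime l N M n m p q) {ρ : ℝ} (hρ : 0 < ρ) :
    ∀ᶠ i in l, 1 / √((n i : ℝ) * m i) ≤ ρ ∧ 1 / √((N i : ℝ) * M i) ≤ ρ := by
  simp only [one_div]
  exact ((h.tendsto_sqrt_mul.inv_tendsto_atTop.eventually_lt_const hρ).mono fun i hi => hi.le).and
    ((h.tendsto_sqrt_mul_total.inv_tendsto_atTop.eventually_lt_const hρ).mono fun i hi => hi.le)

lemma sqrt_mul_eq_div {N M n m : ℕ} :
    √((n : ℝ) * m * ((n : ℝ) / N) * ((m : ℝ) / M)) = (n : ℝ) * m / √((N : ℝ) * M) := by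
  rw [show (n : ℝ) * m * ((n : ℝ) / N) * ((m : ℝ) / M) = ((n : ℝ) * m) ^ 2 / ((N : ℝ) * M) by ring,
    Real.sqrt_div' _ (by positivity), Real.sqrt_sq (by positivity)]

/-- The signal need not tend to zero, so each index is treated by one of two tests: the linear test
at b = s0 + a if a < ρ, the scan test at b = s0 + ρ otherwise. The sum of the two bounds covers both
cases. -/
theorem tendsto_globalError_of_linear [NeZero ν] (h : SparseRegime l N M n m p q)
    (hD : D ⊆ naturalSpace ν) (hs0 : s0 ∈ interior (naturalSpace ν))
    (hA1 : deriv (cumulant ν) s0 = 0) (hA2 : iteratedDeriv 2 (cumulant ν) s0 = 1)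
    (ha : ∀ i, 0 < a i)
    (hlim : Tendsto (fun i => deriv (cumulant ν) (s0 + a i) * √(n i * m i * p i * q i)) l atTop)
    {δ : ℝ} (hδ : 0 < δ) {c : ℝ} (hc : c < 1) {H : ι → ℝ} (hH : Tendsto H l atTop)
    (hHc : ∀ᶠ i in l, H i < c * (deriv (cumulant ν) (s0 + a i) * √(n i * m i * p i * q i))) :
    Tendsto (fun i => globalError ν D s0 (n i) (m i) (a i)
      (combinedTest δ (H i) (N i) (M i) (n i) (m i))) l (𝓝 0) := by
  obtain ⟨ρ, hρ, hQ, hg⟩ := exists_quadraticBound_deriv_pos hs0 hA1 hA2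
  have t1 : Tendsto (fun i => Real.exp (-((1 - c) * (deriv (cumulant ν) (s0 + a i) *
      √(n i * m i * p i * q i))) + 2 / 2)) l (𝓝 0) :=
    Real.tendsto_exp_atBot.comp (tendsto_atBot_add_const_right _ _
      (tendsto_neg_atTop_atBot.comp (hlim.const_mul_atTop (by linarith))))
  have t2 := t1.add (tendsto_exp_scanThreshold h hδ hg)
  rw [add_zero] at t2
  refine tendsto_globalError_of_le h hs0 hA1 hA2 hδ hH (fun i => by positivity) t2 ?_
  filter_upwards [hHc, h.eventually_pos, h.swap.eventually_pos, eventually_one_div_sqrt_le h hρ]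
    with i h1 h2 h3 h4 S hS
  rcases le_or_gt ρ (a i) with hi | hi
  · refine (typeTwoError_scan_le hD hQ h2.1 h3.1 ⟨by linarith, le_rfl⟩ (by linarith) h4.1
      hS).trans (le_add_of_nonneg_left (Real.exp_pos _).le)
  · refine (typeTwoError_lin_le hD hA1 hQ (h2.1.trans_le h2.2.1) (h3.1.trans_le h3.2.1)
      ⟨by linarith [ha i], by linarith⟩ le_rfl h4.2 hS).trans
      ((Real.exp_le_exp.2 ?_).trans (le_add_of_nonneg_right (Real.exp_pos _).le))
    rw [← sqrt_mul_eq_div, ← h.hp, ← h.hq]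
    linarith

theorem tendsto_globalError_of_scan [NeZero ν] (h : SparseRegime l N M n m p q)
    (hD : D ⊆ naturalSpace ν) (hs0 : s0 ∈ interior (naturalSpace ν))
    (hA1 : deriv (cumulant ν) s0 = 0) (hA2 : iteratedDeriv 2 (cumulant ν) s0 = 1)
    (ha : ∀ i, 0 < a i) {b : ℝ} (hb : 1 < b)
    (hlim : ∀ᶠ i in l, b < deriv (cumulant ν) (s0 + a i) * √((n i : ℝ) * m i) /
      √(2 * entropy (n i) (m i) (p i) (q i)))
    {δ : ℝ} (hδ : 0 < δ) (hδb : 2 + 2 * δ < 2 * b ^ 2) {H : ι → ℝ} (hH : Tendsto H l atTop) :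
    Tendsto (fun i => globalError ν D s0 (n i) (m i) (a i)
      (combinedTest δ (H i) (N i) (M i) (n i) (m i))) l (𝓝 0) := by
  obtain ⟨ρ, hρ, hQ, hg⟩ := exists_quadraticBound_deriv_pos hs0 hA1 hA2
  -- With R the entropy, taking ε = δ/(2 + δ) in `log_card_le` gives T² ≤ (2 + 2δ)R, that is T ≤
  -- b'√(2R). Since b' < b, the gap (b - b')√(2R) tends to infinity.
  set b' := √(1 + δ) with hb'
  have hb'2 : b' ^ 2 = 1 + δ := Real.sq_sqrt (by positivity)
  have hb'0 : 0 ≤ b' := Real.sqrt_nonneg _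
  have hbb : b' < b := by
    refine lt_of_pow_lt_pow_left₀ 2 (by linarith) ?_
    rw [hb'2]; linarith
  have hR : Tendsto (fun i => √(2 * entropy (n i) (m i) (p i) (q i))) l atTop :=
    Real.tendsto_sqrt_atTop.comp (h.tendsto_entropy.const_mul_atTop (by norm_num))
  have t1 : Tendsto (fun i => Real.exp (-((b - b') *
      √(2 * entropy (n i) (m i) (p i) (q i))) + 2 / 2)) l (𝓝 0) :=
    Real.tendsto_exp_atBot.comp (tendsto_atBot_add_const_right _ _
      (tendsto_neg_atTop_atBot.comp (hR.const_mul_atTop (by linarith))))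
  have t2 := t1.add (tendsto_exp_scanThreshold h hδ hg)
  rw [add_zero] at t2
  refine tendsto_globalError_of_le h hs0 hA1 hA2 hδ hH (fun i => by positivity) t2 ?_
  filter_upwards [hlim, h.eventually_pos, h.swap.eventually_pos, eventually_one_div_sqrt_le h hρ,
    h.log_card_le (show 0 < δ / (2 + δ) by positivity), hR.eventually_gt_atTop 0,
    h.tendsto_entropy.eventually_gt_atTop 0] with i h1 h2 h3 h4 h5 h6 h7 S hS
  rcases le_or_gt ρ (a i) with hi | hi
  · refine (typeTwoError_scan_le hD hQ h2.1 h3.1 ⟨by linarith, le_rfl⟩ (by linarith) h4.1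
      hS).trans (le_add_of_nonneg_left (Real.exp_pos _).le)
  · refine (typeTwoError_scan_le hD hQ h2.1 h3.1 ⟨by linarith [ha i], by linarith⟩ le_rfl h4.1
      hS).trans ((Real.exp_le_exp.2 ?_).trans (le_add_of_nonneg_right (Real.exp_pos _).le))
    rw [lt_div_iff₀ h6] at h1
    have hT : scanThreshold δ (N i) (M i) (n i) (m i) ≤
        b' * √(2 * entropy (n i) (m i) (p i) (q i)) := by
      rw [hb', ← Real.sqrt_mul (by positivity), scanThreshold]
      refine Real.sqrt_le_sqrt ?_
      have := mul_le_mul_of_nonneg_left h5 (show 0 ≤ 2 + δ by positivity)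
      refine this.trans (le_of_eq ?_)
      field_simp
      ring
    nlinarith

end

/-! ### Overlaps of random submatrices -/

/-- The ratio C(N-b,n-b)/C(N,n) is the product of (n-j)/(N-j) over j < b, and each factor is at most
n/N. -/
lemma choose_sub_mul_pow_le {N n b : ℕ} (hb : b ≤ n) (hn : n ≤ N) :
    (N - b).choose (n - b) * N ^ b ≤ N.choose n * n ^ b := by
  induction b with
  | zero => simp
  | succ b ih =>
    obtain ⟨k, hk⟩ := Nat.exists_eq_add_of_lt (show b < n by omega)
    obtain ⟨K, hK⟩ := Nat.exists_eq_add_of_lt (show b < N by omega)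
    have e1 : n - b = k + 1 := by omega
    have e2 : N - b = K + 1 := by omega
    have e3 : n - (b + 1) = k := by omega
    have e4 : N - (b + 1) = K := by omega
    have h1 := ih (by omega)
    rw [e1, e2] at h1
    rw [e3, e4]
    have h2 := Nat.add_one_mul_choose_eq K k
    have h3 : N * (k + 1) ≤ n * (K + 1) := by
      have : k ≤ K := by omega
      have : b * k ≤ b * K := Nat.mul_le_mul_left b this
      rw [hk, hK]
      nlinarith
    refine Nat.le_of_mul_le_mul_left ?_ (Nat.succ_pos K)
    calc (K + 1) * (K.choose k * N ^ (b + 1))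
        = (K + 1) * K.choose k * N ^ b * N := by ring
      _ = (K + 1).choose (k + 1) * N ^ b * (N * (k + 1)) := by rw [h2]; ring
      _ ≤ (N.choose n * n ^ b) * (n * (K + 1)) := Nat.mul_le_mul h1 h3
      _ = (K + 1) * (N.choose n * n ^ (b + 1)) := by ring

/-- The fraction of `n`-subsets that contain a given set of size `b` is at most `(n / N) ^ b`. -/
lemma card_supersets_le {N n : ℕ} (hn : n ≤ N) (B : Finset (Fin N)) :
    ((((Finset.univ : Finset (Fin N)).powersetCard n).filter (B ⊆ ·)).card : ℝ) ≤
      N.choose n * ((n : ℝ) / N) ^ B.card := by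
  rcases lt_or_ge n B.card with h | h
  · have : ((Finset.univ : Finset (Fin N)).powersetCard n).filter (B ⊆ ·) = ∅ := by
      refine Finset.filter_eq_empty_iff.2 fun A hA hBA => ?_
      have := Finset.card_le_card hBA
      rw [(Finset.mem_powersetCard.1 hA).2] at this
      omega
    rw [this, Finset.card_empty, Nat.cast_zero]
    positivity
  -- Removing `B` maps the supersets injectively to the (n - |B|)-subsets of its complement.
  have h1 : (((Finset.univ : Finset (Fin N)).powersetCard n).filter (B ⊆ ·)).card ≤
      (Bᶜ.powersetCard (n - B.card)).card := by
    refine Finset.card_le_card_of_injOn (· \ B) (fun A hA => ?_) fun A hA A' hA' hAA' => ?_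
    · obtain ⟨hA, hBA⟩ := Finset.mem_filter.1 hA
      refine Finset.mem_coe.2 (Finset.mem_powersetCard.2 ⟨fun x hx => ?_, ?_⟩)
      · exact Finset.mem_compl.2 (Finset.mem_sdiff.1 hx).2
      · rw [Finset.card_sdiff_of_subset hBA, (Finset.mem_powersetCard.1 hA).2]
    · have hBA := (Finset.mem_filter.1 hA).2
      have hBA' := (Finset.mem_filter.1 hA').2
      rw [← Finset.sdiff_union_of_subset hBA, ← Finset.sdiff_union_of_subset hBA']
      exact congrArg (· ∪ B) hAA'
  rw [Finset.card_powersetCard, Finset.card_compl, Fintype.card_fin] at h1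
  rcases Nat.eq_zero_or_pos N with hN | hN
  · subst hN
    have : n = 0 := by omega
    subst this
    have : B.card = 0 := by omega
    rw [this] at h1 ⊢
    simp
  have h2 : ((N - B.card).choose (n - B.card) * N ^ B.card : ℝ) ≤ N.choose n * n ^ B.card := by
    exact_mod_cast choose_sub_mul_pow_le h hn
  have hN' : (0 : ℝ) < N := by exact_mod_cast hN
  rw [div_pow, ← mul_div_assoc, le_div_iff₀ (by positivity)]
  refine le_trans ?_ h2
  gcongr

/-- The exponential moments of the size of the intersection of a fixed set and a uniformly random
set of size `n` are bounded by those of a Poisson variable. -/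
lemma sum_exp_card_inter_le {N n : ℕ} (hn : n ≤ N) {A₀ : Finset (Fin N)} (hA₀ : A₀.card = n)
    {t : ℝ} (ht : 0 ≤ t) :
    ∑ A ∈ (Finset.univ : Finset (Fin N)).powersetCard n, Real.exp (t * (A₀ ∩ A).card) ≤
      N.choose n * Real.exp (n * ((n : ℝ) / N) * (Real.exp t - 1)) := by
  set z := Real.exp t - 1 with hz
  have hz0 : 0 ≤ z := by have := Real.one_le_exp ht; linarith
  -- Binomial expansion of (1 + z)^|A₀ ∩ A| over the subsets of A₀ ∩ A. After the sums are exchanged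
  -- only superset counts are needed, and resummation gives (1 + zn/N)^n ≤ exp(zn²/N).
  have h1 : ∀ A : Finset (Fin N), Real.exp (t * (A₀ ∩ A).card) =
      ∑ B ∈ A₀.powerset, if B ⊆ A then z ^ B.card else 0 := by
    intro A
    rw [mul_comm, Real.exp_nat_mul, show Real.exp t = z + 1 by rw [hz]; ring,
      ← Finset.sum_pow_mul_eq_add_pow, ← Finset.sum_filter]
    simp only [one_pow, mul_one]
    refine Finset.sum_congr ?_ fun _ _ => rfl
    ext B
    rw [Finset.mem_powerset, Finset.subset_inter_iff, Finset.mem_filter, Finset.mem_powerset]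
  simp_rw [h1]
  rw [Finset.sum_comm]
  have h2 : ∀ B ∈ A₀.powerset, (∑ A ∈ (Finset.univ : Finset (Fin N)).powersetCard n,
      if B ⊆ A then z ^ B.card else 0) ≤ N.choose n * (((n : ℝ) / N * z) ^ B.card) := by
    intro B _
    rw [← Finset.sum_filter, Finset.sum_const, nsmul_eq_mul, mul_pow, ← mul_assoc]
    exact mul_le_mul_of_nonneg_right (card_supersets_le hn B) (by positivity)
  refine (Finset.sum_le_sum h2).trans ?_
  rw [← Finset.mul_sum]
  refine mul_le_mul_of_nonneg_left ?_ (by positivity)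
  have h3 := Finset.sum_pow_mul_eq_add_pow ((n : ℝ) / N * z) 1 A₀
  simp only [one_pow, mul_one] at h3
  rw [h3, hA₀, mul_assoc, Real.exp_nat_mul]
  exact pow_le_pow_left₀ (by positivity) (Real.add_one_le_exp _) _

/-- The pairs of row and column sets that index the `n × m` submatrices. -/
def blockIndex (N M n m : ℕ) : Finset (Finset (Fin N) × Finset (Fin M)) :=
  (Finset.univ : Finset (Fin N)).powersetCard n ×ˢ (Finset.univ : Finset (Fin M)).powersetCard m

/-- The parameter matrix equal to `s0 + a` on the submatrix indexed by `P` and to `s0` elsewhere. -/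
noncomputable def planted (s0 a : ℝ) {N M : ℕ} (P : Finset (Fin N) × Finset (Fin M)) :
    Fin N × Fin M → ℝ :=
  fun ij => if ij ∈ P.1 ×ˢ P.2 then s0 + a else s0

/-! ### The truncated second moment method -/

section
variable {ν : Measure ℝ} {N M n m : ℕ} {s0 a : ℝ}

lemma mem_blockIndex {P : Finset (Fin N) × Finset (Fin M)} :
    P ∈ blockIndex N M n m ↔ P.1.card = n ∧ P.2.card = m := by
  simp [blockIndex, Finset.mem_product, Finset.mem_powersetCard]

lemma card_blockIndex : ((blockIndex N M n m).card : ℝ) = N.choose n * M.choose m := by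
  simp [blockIndex]

lemma planted_mem {E : Set ℝ} (h0 : s0 ∈ E) (ha : s0 + a ∈ E)
    (P : Finset (Fin N) × Finset (Fin M)) (ij : Fin N × Fin M) : planted s0 a P ij ∈ E := by
  unfold planted; split_ifs <;> assumption

lemma planted_mem_alternative {D : Set ℝ} (h0 : s0 ∈ D) (ha : s0 + a ∈ D)
    {P : Finset (Fin N) × Finset (Fin M)} (hP : P ∈ blockIndex N M n m) :
    planted s0 a P ∈ alternative D s0 N M n m a := by
  refine ⟨planted_mem h0 ha P, P.1 ×ˢ P.2, ⟨P.1, P.2, (mem_blockIndex.1 hP).1,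
    (mem_blockIndex.1 hP).2, rfl⟩, fun ij hij => if_neg hij, fun ij hij => ?_⟩
  rw [planted, if_pos hij]; linarith

lemma likelihood_planted (P : Finset (Fin N) × Finset (Fin M)) (Y : Fin N × Fin M → ℝ) :
    likelihood ν s0 (planted s0 a P) Y = Real.exp (∑ ij, if ij ∈ P.1 ×ˢ P.2 then
      a * Y ij - (cumulant ν (s0 + a) - cumulant ν s0) else 0) := by
  rw [likelihood, ← Finset.sum_sub_distrib]
  congr 1
  refine Finset.sum_congr rfl fun ij _ => ?_
  unfold planted
  split_ifs <;> ring

/-- Joint exponential moments of two likelihood ratios and the sum of the entries in the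
intersection of the two submatrices. -/
lemma integral_likelihood_mul [NeZero ν] {c : ℝ} (h0 : s0 ∈ naturalSpace ν)
    (h1 : s0 + a ∈ naturalSpace ν) (h2 : s0 + (2 * a + c) ∈ naturalSpace ν)
    (P Q : Finset (Fin N) × Finset (Fin M)) :
    Integrable (fun Y => likelihood ν s0 (planted s0 a P) Y * likelihood ν s0 (planted s0 a Q) Y *
      Real.exp (c * ∑ ij ∈ (P.1 ∩ Q.1) ×ˢ (P.2 ∩ Q.2), Y ij)) (nullLaw ν s0 N M) ∧
    ∫ Y, likelihood ν s0 (planted s0 a P) Y * likelihood ν s0 (planted s0 a Q) Y *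
      Real.exp (c * ∑ ij ∈ (P.1 ∩ Q.1) ×ˢ (P.2 ∩ Q.2), Y ij) ∂nullLaw ν s0 N M =
    Real.exp ((P.1 ∩ Q.1).card * (P.2 ∩ Q.2).card *
      ((cumulant ν (s0 + (2 * a + c)) - cumulant ν s0) -
        2 * (cumulant ν (s0 + a) - cumulant ν s0))) := by
  set φ := cumulant ν (s0 + a) - cumulant ν s0 with hφ
  set V := (P.1 ∩ Q.1) ×ˢ (P.2 ∩ Q.2) with hV
  have hmem : ∀ ij, ij ∈ V ↔ ij ∈ P.1 ×ˢ P.2 ∧ ij ∈ Q.1 ×ˢ Q.2 := by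
    intro ij
    simp only [hV, Finset.mem_product, Finset.mem_inter]
    tauto
  set h : Fin N × Fin M → ℝ := fun ij => (if ij ∈ P.1 ×ˢ P.2 then a else 0) +
    (if ij ∈ Q.1 ×ˢ Q.2 then a else 0) + (if ij ∈ V then c else 0) with hh
  set e : Fin N × Fin M → ℝ := fun ij => (if ij ∈ P.1 ×ˢ P.2 then φ else 0) +
    (if ij ∈ Q.1 ×ˢ Q.2 then φ else 0) with he
  have hS : ∀ ij, (fun _ : Fin N × Fin M => s0) ij ∈ naturalSpace ν := fun _ => h0
  have hSh : ∀ ij, (fun _ : Fin N × Fin M => s0) ij + h ij ∈ naturalSpace ν := by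
    intro ij
    by_cases hP : ij ∈ P.1 ×ˢ P.2 <;> by_cases hQ : ij ∈ Q.1 ×ˢ Q.2 <;>
      simp only [hh, hmem, hP, hQ, if_true, if_false, and_true, and_false, and_self, add_zero,
        zero_add]
    · rwa [← two_mul]
    · exact h1
    · exact h1
    · exact h0
  have e1 : ∀ Y, likelihood ν s0 (planted s0 a P) Y * likelihood ν s0 (planted s0 a Q) Y *
      Real.exp (c * ∑ ij ∈ V, Y ij) = Real.exp (∑ ij, h ij * Y ij) * Real.exp (-∑ ij, e ij) := by
    intro Y
    rw [likelihood_planted, likelihood_planted, ← Real.exp_add, ← Real.exp_add, ← Real.exp_add]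
    congr 1
    have e2 : c * ∑ ij ∈ V, Y ij = ∑ ij, if ij ∈ V then c * Y ij else 0 := by
      rw [Finset.mul_sum, Finset.sum_ite_mem, Finset.univ_inter]
    rw [e2, ← Finset.sum_add_distrib, ← Finset.sum_add_distrib, ← Finset.sum_neg_distrib,
      ← Finset.sum_add_distrib]
    refine Finset.sum_congr rfl fun ij _ => ?_
    simp only [hh, he]
    split_ifs <;> ring
  simp only [e1]
  refine ⟨(integrable_exp_matrixLaw hS hSh).mul_const _, ?_⟩
  rw [integral_mul_const]
  unfold nullLaw
  rw [integral_exp_matrixLaw hS hSh, ← Real.exp_add]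
  congr 1
  have e3 : ((P.1 ∩ Q.1).card : ℝ) * (P.2 ∩ Q.2).card *
      ((cumulant ν (s0 + (2 * a + c)) - cumulant ν s0) - 2 * φ) =
      ∑ ij, if ij ∈ V then (cumulant ν (s0 + (2 * a + c)) - cumulant ν s0) - 2 * φ else 0 := by
    rw [Finset.sum_ite_mem, Finset.univ_inter, Finset.sum_const, hV, Finset.card_product,
      nsmul_eq_mul, Nat.cast_mul]
  rw [e3, ← Finset.sum_neg_distrib, ← Finset.sum_add_distrib]
  refine Finset.sum_congr rfl fun ij _ => ?_
  -- Entries of exactly one of the two submatrices contribute φ - φ = 0, so only the overlap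
  -- remains.
  by_cases hP : ij ∈ P.1 ×ˢ P.2 <;> by_cases hQ : ij ∈ Q.1 ×ˢ Q.2 <;>
    simp only [hh, he, hmem, hP, hQ, if_true, if_false, and_true, and_false, and_self, add_zero,
      zero_add]
  · rw [← two_mul]; ring
  · rw [hφ]; ring
  · rw [hφ]; ring
  · ring

lemma integrable_likelihood_mul [NeZero ν] (h0 : s0 ∈ naturalSpace ν)
    (h1 : s0 + a ∈ naturalSpace ν) (h2 : s0 + 2 * a ∈ naturalSpace ν)
    (P Q : Finset (Fin N) × Finset (Fin M)) :
    Integrable (fun Y => likelihood ν s0 (planted s0 a P) Y * likelihood ν s0 (planted s0 a Q) Y)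
      (nullLaw ν s0 N M) := by
  have := (integral_likelihood_mul (c := 0) h0 h1 (by simpa using h2) P Q).1
  simpa using this

/-- **Truncated second moment method**: if the second moment of the averaged likelihood ratio,
truncated by the weights `g P`, is close to one and the truncation has little effect under the
planted laws, then no test can do much better than a trivial one. -/
lemma one_sub_le_maxTypeTwoError [NeZero ν] {D : Set ℝ} (hD : D ⊆ naturalSpace ν)
    (h0 : s0 ∈ D) (h1 : s0 + a ∈ D) (h2 : s0 + 2 * a ∈ naturalSpace ν)
    (hn : n ≤ N) (hm : m ≤ M)
    {g : Finset (Fin N) × Finset (Fin M) → (Fin N × Fin M → ℝ) → ℝ}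
    (hg : ∀ P, Measurable (g P)) (hg01 : ∀ P Y, 0 ≤ g P Y ∧ g P Y ≤ 1) {η₁ η₂ ε : ℝ}
    (hη₁ : ∀ P ∈ blockIndex N M n m, ∫ Y, (1 - g P Y) ∂matrixLaw ν (planted s0 a P) ≤ η₁)
    (hη₂ : ∑ P ∈ blockIndex N M n m, ∑ Q ∈ blockIndex N M n m,
      ∫ Y, (likelihood ν s0 (planted s0 a P) Y * g P Y) *
        (likelihood ν s0 (planted s0 a Q) Y * g Q Y) ∂nullLaw ν s0 N M ≤
      (1 + η₂) * ((N.choose n : ℝ) * M.choose m) ^ 2)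
    (hε : 0 < ε) (hηε : η₂ + 2 * η₁ ≤ ε ^ 2)
    {ψ : (Fin N × Fin M → ℝ) → ℝ} (hψ : IsTest ψ) :
    1 - typeOneError ν s0 ψ - ε ≤ maxTypeTwoError ν D s0 n m a ψ := by
  have h0' := hD h0
  have h1' := hD h1
  set μ := nullLaw ν s0 N M with hμ
  have hprob : IsProbabilityMeasure μ := isProbabilityMeasure_matrixLaw fun _ => h0'
  have hSn : ∀ (P : Finset (Fin N) × Finset (Fin M)) ij, planted s0 a P ij ∈ naturalSpace ν :=
    fun P => planted_mem h0' h1' P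
  set G : ℝ := (N.choose n : ℝ) * M.choose m with hG
  have hG0 : 0 < G := by
    have := Nat.choose_pos hn
    have := Nat.choose_pos hm
    positivity
  set f : Finset (Fin N) × Finset (Fin M) → (Fin N × Fin M → ℝ) → ℝ :=
    fun P Y => likelihood ν s0 (planted s0 a P) Y * g P Y with hf
  have hfm : ∀ P, Measurable (f P) := fun P => (measurable_likelihood s0 _).mul (hg P)
  have hlik0 : ∀ (P : Finset (Fin N) × Finset (Fin M)) (Y : Fin N × Fin M → ℝ),
      0 ≤ likelihood ν s0 (planted s0 a P) Y := fun P Y => (Real.exp_pos _).le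
  have hf0 : ∀ P Y, 0 ≤ f P Y := fun P Y => mul_nonneg (hlik0 P Y) (hg01 P Y).1
  have hfle : ∀ P Y, f P Y ≤ likelihood ν s0 (planted s0 a P) Y := fun P Y =>
    mul_le_of_le_one_right (hlik0 P Y) (hg01 P Y).2
  have hfi : ∀ P, Integrable (f P) μ := fun P =>
    (integrable_likelihood h0' (hSn P)).mono' (hfm P).aestronglyMeasurable
      (ae_of_all _ fun Y => by rw [Real.norm_of_nonneg (hf0 P Y)]; exact hfle P Y)
  have hffi : ∀ P Q, Integrable (fun Y => f P Y * f Q Y) μ := fun P Q =>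
    (integrable_likelihood_mul h0' h1' h2 P Q).mono' ((hfm P).mul (hfm Q)).aestronglyMeasurable
      (ae_of_all _ fun Y => by
        rw [Real.norm_of_nonneg (mul_nonneg (hf0 P Y) (hf0 Q Y))]
        exact mul_le_mul (hfle P Y) (hfle Q Y) (hf0 Q Y) (hlik0 P Y))
  set I := blockIndex N M n m with hI
  have hIcard : (I.card : ℝ) = G := card_blockIndex
  set L : (Fin N × Fin M → ℝ) → ℝ := fun Y => G⁻¹ * ∑ P ∈ I, f P Y with hL
  have hLm : Measurable L := (Finset.measurable_sum I fun P _ => hfm P).const_mul _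
  have hLi : Integrable L μ := (integrable_finsetSum I fun P _ => hfi P).const_mul _
  have hL2 : ∀ Y, L Y ^ 2 = (G⁻¹) ^ 2 * ∑ P ∈ I, ∑ Q ∈ I, f P Y * f Q Y := by
    intro Y
    rw [hL, mul_pow, ← Finset.sum_mul_sum, sq (∑ P ∈ I, f P Y)]
  have hL2i : Integrable (fun Y => L Y ^ 2) μ := by
    simp only [hL2]
    exact (integrable_finsetSum I fun P _ => integrable_finsetSum I fun Q _ => hffi P Q).const_mul _
  have hEL2 : ∫ Y, L Y ^ 2 ∂μ ≤ 1 + η₂ := by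
    simp only [hL2]
    rw [integral_const_mul, integral_finsetSum I fun P _ => integrable_finsetSum I fun Q _ =>
      hffi P Q]
    simp_rw [integral_finsetSum I fun Q _ => hffi _ Q]
    rw [inv_pow, inv_mul_le_iff₀ (by positivity), mul_comm]
    exact hη₂
  have hEf : ∀ P ∈ I, 1 - η₁ ≤ ∫ Y, f P Y ∂μ := by
    intro P hP
    have hpP := isProbabilityMeasure_matrixLaw (hSn P)
    have hgi : Integrable (g P) (matrixLaw ν (planted s0 a P)) :=
      Integrable.of_bound (hg P).aestronglyMeasurable 1 (ae_of_all _ fun Y => by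
        rw [Real.norm_of_nonneg (hg01 P Y).1]; exact (hg01 P Y).2)
    have h3 := hη₁ P hP
    rw [integral_sub (integrable_const _) hgi, integral_const, smul_eq_mul, mul_one,
      probReal_univ, integral_matrixLaw h0' (hSn P)] at h3
    linarith
  have hEL : 1 - η₁ ≤ ∫ Y, L Y ∂μ := by
    rw [hL, integral_const_mul, integral_finsetSum I fun P _ => hfi P,
      le_inv_mul_iff₀ hG0, ← hIcard, ← nsmul_eq_mul]
    exact Finset.card_nsmul_le_sum _ _ _ hEf
  have hLLi : Integrable (fun Y => L Y ^ 2 - 2 * L Y) μ := hL2i.sub (hLi.const_mul 2)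
  -- E(L - 1)² = E L² - 2 E L + 1 ≤ (1 + η₂) - 2(1 - η₁) + 1 = η₂ + 2η₁. Truncation makes E L at
  -- most 1, so its defect enters here.
  have hV : ∫ Y, (L Y - 1) ^ 2 ∂μ ≤ ε ^ 2 := by
    have e1 : ∀ Y, (L Y - 1) ^ 2 = L Y ^ 2 - 2 * L Y + 1 := fun Y => by ring
    simp only [e1]
    rw [integral_add hLLi (integrable_const _),
      integral_sub hL2i (hLi.const_mul 2), integral_const_mul, integral_const, smul_eq_mul,
      mul_one, probReal_univ]
    linarith
  have hVi : Integrable (fun Y => (L Y - 1) ^ 2) μ := by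
    have e1 : ∀ Y, (L Y - 1) ^ 2 = L Y ^ 2 - 2 * L Y + 1 := fun Y => by ring
    simp only [e1]
    exact hLLi.add (integrable_const _)
  have hψ1 : ∀ Y, |1 - ψ Y| ≤ 1 := fun Y => abs_le.2
    ⟨by linarith [(hψ.2 Y).1, (hψ.2 Y).2], by linarith [(hψ.2 Y).1]⟩
  have hψm : Measurable fun Y => 1 - ψ Y := measurable_const.sub hψ.1
  have hψi : Integrable ψ μ := Integrable.of_bound hψ.1.aestronglyMeasurable 1
    (ae_of_all _ fun Y => by rw [Real.norm_of_nonneg (hψ.2 Y).1]; exact (hψ.2 Y).2)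
  have hψi' : Integrable (fun Y => 1 - ψ Y) μ := (integrable_const _).sub hψi
  have hLψ : Integrable (fun Y => L Y * (1 - ψ Y)) μ :=
    hLi.mul_bdd (c := 1) hψm.aestronglyMeasurable (ae_of_all _ hψ1)
  have hfψ : ∀ P, Integrable (fun Y => f P Y * (1 - ψ Y)) μ := fun P =>
    (hfi P).mul_bdd (c := 1) hψm.aestronglyMeasurable (ae_of_all _ hψ1)
  have step1 : 1 - typeOneError ν s0 ψ - ε ≤ ∫ Y, L Y * (1 - ψ Y) ∂μ := by
    have e1 : 1 - typeOneError ν s0 ψ = ∫ Y, (1 - ψ Y) ∂μ := by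
      rw [integral_sub (integrable_const _) hψi, integral_const, smul_eq_mul, mul_one,
        probReal_univ, typeOneError]
    -- The inequality |x| ≤ ε/2 + x²/(2ε) takes the place of Cauchy–Schwarz.
    have e2 : ∫ Y, (1 - ψ Y) ∂μ - ∫ Y, L Y * (1 - ψ Y) ∂μ ≤
        ∫ Y, (ε / 2 + (2 * ε)⁻¹ * (L Y - 1) ^ 2) ∂μ := by
      rw [← integral_sub hψi' hLψ]
      refine integral_mono (hψi'.sub hLψ)
        ((integrable_const _).add (hVi.const_mul _)) fun Y => ?_
      have h3 : (1 - ψ Y) - L Y * (1 - ψ Y) ≤ |L Y - 1| := by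
        calc (1 - ψ Y) - L Y * (1 - ψ Y) = -((L Y - 1) * (1 - ψ Y)) := by ring
          _ ≤ |(L Y - 1) * (1 - ψ Y)| := neg_le_abs _
          _ = |L Y - 1| * |1 - ψ Y| := abs_mul _ _
          _ ≤ |L Y - 1| := mul_le_of_le_one_right (abs_nonneg _) (hψ1 Y)
      refine h3.trans ?_
      have h4 : 0 ≤ (2 * ε)⁻¹ * (|L Y - 1| - ε) ^ 2 := by positivity
      have h5 : (2 * ε)⁻¹ * (|L Y - 1| - ε) ^ 2 =
          (2 * ε)⁻¹ * (L Y - 1) ^ 2 - |L Y - 1| + ε / 2 := by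
        rw [← sq_abs (L Y - 1)]
        field_simp
        ring
      linarith
    rw [integral_add (integrable_const _) (hVi.const_mul _), integral_const_mul, integral_const,
      smul_eq_mul, probReal_univ, one_mul] at e2
    have e3 : (2 * ε)⁻¹ * ∫ Y, (L Y - 1) ^ 2 ∂μ ≤ ε / 2 := by
      rw [inv_mul_le_iff₀ (by positivity)]
      linarith [hV]
    linarith
  -- An average over planted submatrices is at most the supremum, and undoing the truncation only
  -- increases each term.
  refine step1.trans ?_
  rw [hL]
  simp_rw [mul_assoc, Finset.sum_mul]
  rw [integral_const_mul, integral_finsetSum I fun P _ => hfψ P, inv_mul_le_iff₀ hG0, ← hIcard,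
    ← nsmul_eq_mul]
  refine Finset.sum_le_card_nsmul _ _ _ fun P hP => ?_
  have hbdd : BddAbove (Set.range fun S : alternative D s0 N M n m a =>
      typeTwoError ν ψ S.1) := by
    refine ⟨1, ?_⟩
    rintro _ ⟨S, rfl⟩
    have := isProbabilityMeasure_matrixLaw fun ij => hD (S.2.1 ij)
    have h3 : ∫ Y, (1 - ψ Y) ∂matrixLaw ν S.1 ≤ ∫ _, (1 : ℝ) ∂matrixLaw ν S.1 :=
      integral_mono_of_nonneg (ae_of_all _ fun Y => sub_nonneg.2 (hψ.2 Y).2)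
        (integrable_const _) (ae_of_all _ fun Y => by
          simp only; linarith [(hψ.2 Y).1])
    simpa [typeTwoError] using h3
  refine le_trans ?_ (le_ciSup hbdd ⟨planted s0 a P, planted_mem_alternative h0 h1 hP⟩)
  rw [typeTwoError, integral_matrixLaw h0' (hSn P)]
  refine integral_mono (hfψ P) ((integrable_likelihood h0' (hSn P)).mul_bdd (c := 1)
    hψm.aestronglyMeasurable (ae_of_all _ hψ1)) fun Y => ?_
  exact mul_le_mul_of_nonneg_right (hfle P Y) (sub_nonneg.2 (hψ.2 Y).2)

end

/-- The truncation event: the sum of the observations over each large submatrix of the submatrix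
indexed by `P` exceeds its mean under the planted law by at most `d` standard deviations. -/
noncomputable def truncationSet (ν : Measure ℝ) (s0 a δ d : ℝ) {N M : ℕ} (n m : ℕ)
    (P : Finset (Fin N) × Finset (Fin M)) : Set (Fin N × Fin M → ℝ) :=
  ⋂ A ∈ P.1.powerset, ⋂ B ∈ P.2.powerset,
    {Y | δ * n < A.card → δ * m < B.card → ∑ ij ∈ A ×ˢ B, Y ij ≤
      A.card * B.card * deriv (cumulant ν) (s0 + a) + √((A.card : ℝ) * B.card) * d}

/-! ### Truncation and the cross moments of truncated likelihoods -/

section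
variable {ν : Measure ℝ} {N M n m : ℕ} {s0 a δ d K ρ : ℝ}

lemma mem_truncationSet {P : Finset (Fin N) × Finset (Fin M)} {Y : Fin N × Fin M → ℝ} :
    Y ∈ truncationSet ν s0 a δ d n m P ↔ ∀ A ⊆ P.1, ∀ B ⊆ P.2,
      δ * n < A.card → δ * m < B.card → ∑ ij ∈ A ×ˢ B, Y ij ≤
        A.card * B.card * deriv (cumulant ν) (s0 + a) + √((A.card : ℝ) * B.card) * d := by
  simp [truncationSet]

lemma measurableSet_truncationSet (P : Finset (Fin N) × Finset (Fin M)) :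
    MeasurableSet (truncationSet ν s0 a δ d n m P) := by
  refine Finset.measurableSet_biInter _ fun A _ => Finset.measurableSet_biInter _ fun B _ => ?_
  by_cases h1 : δ * n < A.card <;> by_cases h2 : δ * m < B.card <;>
    simp only [h1, h2, true_imp_iff, false_imp_iff, Set.ofPred_true, MeasurableSet.univ]
  exact measurableSet_le (by fun_prop) measurable_const

/-- The indicator function of the truncation event. -/
noncomputable def truncationWeight (ν : Measure ℝ) (s0 a δ d : ℝ) {N M : ℕ} (n m : ℕ)
    (P : Finset (Fin N) × Finset (Fin M)) : (Fin N × Fin M → ℝ) → ℝ :=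
  (truncationSet ν s0 a δ d n m P).indicator 1

lemma measurable_truncationWeight (P : Finset (Fin N) × Finset (Fin M)) :
    Measurable (truncationWeight ν s0 a δ d n m P) :=
  measurable_one.indicator (measurableSet_truncationSet P)

lemma truncationWeight_mem (P : Finset (Fin N) × Finset (Fin M)) (Y : Fin N × Fin M → ℝ) :
    0 ≤ truncationWeight ν s0 a δ d n m P Y ∧ truncationWeight ν s0 a δ d n m P Y ≤ 1 := by
  classical
  unfold truncationWeight
  rw [Set.indicator_apply]
  split_ifs <;> simp

variable [NeZero ν]

/-- The truncation has little effect under the planted law. -/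
lemma integral_one_sub_truncationWeight_le (hQ : QuadraticBound ν s0 K ρ) (hK : 0 < K)
    (hδ : 0 < δ) (hd : 0 < d) (ha : 0 < a) (haρ : a ≤ ρ / 2) (hn : 0 < n) (hm : 0 < m)
    (hdρ : d / (K * (δ * √((n : ℝ) * m))) ≤ ρ / 2)
    {P : Finset (Fin N) × Finset (Fin M)} (hP : P ∈ blockIndex N M n m) :
    ∫ Y, (1 - truncationWeight ν s0 a δ d n m P Y) ∂matrixLaw ν (planted s0 a P) ≤
      2 ^ n * 2 ^ m * Real.exp (-(d ^ 2 / (2 * K))) := by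
  classical
  have hn' : (0 : ℝ) < n := by exact_mod_cast hn
  have hm' : (0 : ℝ) < m := by exact_mod_cast hm
  have hs0 : s0 ∈ naturalSpace ν := (hQ s0 ⟨by linarith, by linarith⟩).1
  have haI : s0 + a ∈ Set.Icc (s0 - ρ) (s0 + ρ) := ⟨by linarith, by linarith⟩
  have hSn := planted_mem hs0 (hQ _ haI).1 P
  set g := deriv (cumulant ν) (s0 + a) with hg
  -- Exponential Markov weight of one block, zero for blocks too small to be constrained. The sum of
  -- the weights dominates the indicator of the truncated part.
  set w : Finset (Fin N) → Finset (Fin M) → (Fin N × Fin M → ℝ) → ℝ := fun A B Y =>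
    if δ * n < A.card ∧ δ * m < B.card then
      Real.exp (d / (K * √((A.card : ℝ) * B.card)) * ∑ ij ∈ A ×ˢ B, Y ij) *
        Real.exp (-(d / (K * √((A.card : ℝ) * B.card)) *
          (A.card * B.card * g + √((A.card : ℝ) * B.card) * d))) else 0 with hw
  have hw0 : ∀ A B Y, 0 ≤ w A B Y := by
    intro A B Y
    simp only [hw]
    split_ifs <;> positivity
  have key : ∀ A ⊆ P.1, ∀ B ⊆ P.2, Integrable (w A B) (matrixLaw ν (planted s0 a P)) ∧
      ∫ Y, w A B Y ∂matrixLaw ν (planted s0 a P) ≤ Real.exp (-(d ^ 2 / (2 * K))) := by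
    intro A hA B hB
    simp only [hw]
    split_ifs with hAB
    · have hk : 0 < δ * n := by positivity
      have hl : 0 < δ * m := by positivity
      set r := √((A.card : ℝ) * B.card) with hr
      have hr2 : r ^ 2 = (A.card : ℝ) * B.card := Real.sq_sqrt (by positivity)
      have hr0 : 0 < r := Real.sqrt_pos.2 (mul_pos (hk.trans hAB.1) (hl.trans hAB.2))
      have hrle : δ * √((n : ℝ) * m) ≤ r := by
        rw [hr, Real.le_sqrt (by positivity) (by positivity), mul_pow,
          Real.sq_sqrt (by positivity)]
        calc δ ^ 2 * ((n : ℝ) * m) = (δ * n) * (δ * m) := by ring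
          _ ≤ A.card * B.card := mul_le_mul hAB.1.le hAB.2.le hl.le (by positivity)
      have hsq : 0 < √((n : ℝ) * m) := Real.sqrt_pos.2 (by positivity)
      -- This tilt minimizes K r² t²/2 - t r d, with minimum -d²/(2K).
      set t := d / (K * r) with ht
      have ht0 : 0 < t := by positivity
      have htρ : t ≤ ρ / 2 := by
        refine le_trans ?_ hdρ
        rw [ht]
        gcongr
      have htI : s0 + a + t ∈ Set.Icc (s0 - ρ) (s0 + ρ) := ⟨by linarith, by linarith⟩
      have hin : ∀ ij ∈ A ×ˢ B, planted s0 a P ij = s0 + a := fun ij hij =>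
        if_pos (Finset.product_subset_product hA hB hij)
      obtain ⟨hi, he⟩ := exp_sum_matrixLaw hSn (A ×ˢ B) (c := t) fun ij hij => by
        rw [hin ij hij]; exact (hQ _ htI).1
      refine ⟨hi.mul_const _, ?_⟩
      rw [integral_mul_const, he, ← Real.exp_add, Real.exp_le_exp]
      rw [Finset.sum_congr rfl fun ij hij => by rw [hin ij hij], Finset.sum_const,
        Finset.card_product, nsmul_eq_mul, Nat.cast_mul, ← hr2]
      have h3 := mul_le_mul_of_nonneg_left ((hQ _ haI).2 _ htI) (sq_nonneg r)
      rw [← hg] at h3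
      have h4 : r ^ 2 * ((s0 + a + t - (s0 + a)) * g + K / 2 * (s0 + a + t - (s0 + a)) ^ 2) +
          -(t * (r ^ 2 * g + r * d)) = -(d ^ 2 / (2 * K)) := by
        rw [ht]; field_simp; ring
      linarith
    · refine ⟨integrable_zero _ _ _, ?_⟩
      rw [integral_zero]
      positivity
  have hint : Integrable (fun Y => ∑ A ∈ P.1.powerset, ∑ B ∈ P.2.powerset, w A B Y)
      (matrixLaw ν (planted s0 a P)) :=
    integrable_finsetSum _ fun A hA => integrable_finsetSum _ fun B hB =>
      (key A (Finset.mem_powerset.1 hA) B (Finset.mem_powerset.1 hB)).1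
  refine (integral_mono_of_nonneg (ae_of_all _ fun Y =>
    sub_nonneg.2 (truncationWeight_mem P Y).2) hint (ae_of_all _ fun Y => ?_)).trans ?_
  · by_cases hY : Y ∈ truncationSet ν s0 a δ d n m P
    · simp only [truncationWeight, Set.indicator_of_mem hY, Pi.one_apply, sub_self]
      exact Finset.sum_nonneg fun A _ => Finset.sum_nonneg fun B _ => hw0 A B Y
    · simp only [truncationWeight, Set.indicator_of_notMem hY, sub_zero]
      rw [mem_truncationSet] at hY
      push Not at hY
      obtain ⟨A, hA, B, hB, h1, h2, h3⟩ := hY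
      refine le_trans ?_ (Finset.single_le_sum (fun A _ => Finset.sum_nonneg fun B _ => hw0 A B Y)
        (Finset.mem_powerset.2 hA))
      refine le_trans ?_ (Finset.single_le_sum (fun B _ => hw0 A B Y) (Finset.mem_powerset.2 hB))
      simp only [hw]
      rw [if_pos ⟨h1, h2⟩, ← Real.exp_add]
      refine Real.one_le_exp ?_
      rw [← sub_eq_add_neg, ← mul_sub]
      exact mul_nonneg (by positivity) (by rw [← hg] at h3; linarith)
  · rw [integral_finsetSum _ fun A hA => integrable_finsetSum _ fun B hB =>
      (key A (Finset.mem_powerset.1 hA) B (Finset.mem_powerset.1 hB)).1]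
    have hb : ∀ A ∈ P.1.powerset, ∫ Y, ∑ B ∈ P.2.powerset, w A B Y
        ∂matrixLaw ν (planted s0 a P) ≤ 2 ^ m * Real.exp (-(d ^ 2 / (2 * K))) := by
      intro A hA
      rw [integral_finsetSum _ fun B hB =>
        (key A (Finset.mem_powerset.1 hA) B (Finset.mem_powerset.1 hB)).1]
      refine (Finset.sum_le_card_nsmul _ _ _ fun B hB =>
        (key A (Finset.mem_powerset.1 hA) B (Finset.mem_powerset.1 hB)).2).trans (le_of_eq ?_)
      rw [Finset.card_powerset, (mem_blockIndex.1 hP).2, nsmul_eq_mul]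
      push_cast; rfl
    refine (Finset.sum_le_card_nsmul _ _ _ hb).trans (le_of_eq ?_)
    rw [Finset.card_powerset, (mem_blockIndex.1 hP).1, nsmul_eq_mul]
    push_cast; ring

/-- Bounds for the cross moments of the truncated likelihood ratios. -/
lemma integral_truncated_mul_le (hQ : QuadraticBound ν s0 K ρ) (ha : 0 < a) (haρ : a ≤ ρ / 2)
    (P Q : Finset (Fin N) × Finset (Fin M)) {k l : ℕ} (hk : (P.1 ∩ Q.1).card = k)
    (hl : (P.2 ∩ Q.2).card = l) :
    (∫ Y, (likelihood ν s0 (planted s0 a P) Y * truncationWeight ν s0 a δ d n m P Y) *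
        (likelihood ν s0 (planted s0 a Q) Y * truncationWeight ν s0 a δ d n m Q Y)
        ∂nullLaw ν s0 N M ≤ Real.exp (K * a ^ 2 * k * l)) ∧
    (δ * n < k → δ * m < l →
      ∫ Y, (likelihood ν s0 (planted s0 a P) Y * truncationWeight ν s0 a δ d n m P Y) *
        (likelihood ν s0 (planted s0 a Q) Y * truncationWeight ν s0 a δ d n m Q Y)
        ∂nullLaw ν s0 N M ≤ Real.exp (K * a ^ 2 * k * l / 2 + a * √((k : ℝ) * l) * d)) := by
  have hI0 : s0 ∈ Set.Icc (s0 - ρ) (s0 + ρ) := ⟨by linarith, by linarith⟩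
  have hI1 : s0 + a ∈ Set.Icc (s0 - ρ) (s0 + ρ) := ⟨by linarith, by linarith⟩
  have hI2 : s0 + 2 * a ∈ Set.Icc (s0 - ρ) (s0 + ρ) := ⟨by linarith, by linarith⟩
  have q1 := (hQ _ hI1).2 _ hI0
  have q2 := (hQ _ hI1).2 _ hI2
  set g := deriv (cumulant ν) (s0 + a) with hg
  have hkl : (0 : ℝ) ≤ k * l := by positivity
  have hL0 : ∀ (P : Finset (Fin N) × Finset (Fin M)) Y, 0 ≤ likelihood ν s0 (planted s0 a P) Y :=
    fun P Y => (Real.exp_pos _).le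
  have hnn : ∀ Y, 0 ≤
      (likelihood ν s0 (planted s0 a P) Y * truncationWeight ν s0 a δ d n m P Y) *
        (likelihood ν s0 (planted s0 a Q) Y * truncationWeight ν s0 a δ d n m Q Y) := fun Y =>
    mul_nonneg (mul_nonneg (hL0 P Y) (truncationWeight_mem P Y).1)
      (mul_nonneg (hL0 Q Y) (truncationWeight_mem Q Y).1)
  refine ⟨?_, fun hδk hδl => ?_⟩
  -- No truncation is used here. Expanding at `s0 + a` in both directions, the linear terms cancel
  -- and A(s0 + 2a) + A(s0) - 2A(s0 + a) ≤ K a² remains.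
  · obtain ⟨hi, he⟩ := integral_likelihood_mul (c := 0) (hQ _ hI0).1 (hQ _ hI1).1
      (by rw [add_zero]; exact (hQ _ hI2).1) P Q
    refine (integral_mono_of_nonneg (ae_of_all _ hnn) hi (ae_of_all _ fun Y => ?_)).trans ?_
    · simp only [zero_mul, Real.exp_zero, mul_one]
      exact mul_le_mul (mul_le_of_le_one_right (hL0 P Y) (truncationWeight_mem P Y).2)
        (mul_le_of_le_one_right (hL0 Q Y) (truncationWeight_mem Q Y).2)
        (mul_nonneg (hL0 Q Y) (truncationWeight_mem Q Y).1) (hL0 P Y)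
    · rw [he, hk, hl, Real.exp_le_exp, add_zero]
      have h3 : cumulant ν (s0 + 2 * a) - cumulant ν s0 -
          2 * (cumulant ν (s0 + a) - cumulant ν s0) ≤ K * a ^ 2 := by
        nlinarith
      calc (k : ℝ) * l * (cumulant ν (s0 + 2 * a) - cumulant ν s0 -
          2 * (cumulant ν (s0 + a) - cumulant ν s0)) ≤ k * l * (K * a ^ 2) :=
            mul_le_mul_of_nonneg_left h3 hkl
        _ = K * a ^ 2 * k * l := by ring
  -- On the truncation event of `P` the overlap sum is at most T, so the indicator is below exp(a(T
  -- - sum)). The tilt -a cancels one of the two factors on the overlap, which halves the quadratic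
  -- exponent. The truncation of `Q` is discarded.
  · obtain ⟨hi, he⟩ := integral_likelihood_mul (c := -a) (hQ _ hI0).1 (hQ _ hI1).1
      (by rw [show s0 + (2 * a + -a) = s0 + a by ring]; exact (hQ _ hI1).1) P Q
    set T := (k : ℝ) * l * g + √((k : ℝ) * l) * d with hT
    refine (integral_mono_of_nonneg (ae_of_all _ hnn) (hi.mul_const (Real.exp (a * T)))
      (ae_of_all _ fun Y => ?_)).trans ?_
    · have hwt : truncationWeight ν s0 a δ d n m P Y ≤
          Real.exp (-a * ∑ ij ∈ (P.1 ∩ Q.1) ×ˢ (P.2 ∩ Q.2), Y ij) * Real.exp (a * T) := by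
        rw [← Real.exp_add]
        by_cases hY : Y ∈ truncationSet ν s0 a δ d n m P
        · simp only [truncationWeight, Set.indicator_of_mem hY, Pi.one_apply]
          have := mem_truncationSet.1 hY _ Finset.inter_subset_left _ Finset.inter_subset_left
            (by rw [hk]; exact hδk) (by rw [hl]; exact hδl)
          rw [hk, hl, ← hg, ← hT] at this
          refine Real.one_le_exp ?_
          nlinarith
        · simp only [truncationWeight, Set.indicator_of_notMem hY]
          positivity
      simp only
      calc _ ≤ (likelihood ν s0 (planted s0 a P) Y *
              (Real.exp (-a * ∑ ij ∈ (P.1 ∩ Q.1) ×ˢ (P.2 ∩ Q.2), Y ij) * Real.exp (a * T))) *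
            likelihood ν s0 (planted s0 a Q) Y :=
            mul_le_mul (mul_le_mul_of_nonneg_left hwt (hL0 P Y))
              (mul_le_of_le_one_right (hL0 Q Y) (truncationWeight_mem Q Y).2)
              (mul_nonneg (hL0 Q Y) (truncationWeight_mem Q Y).1)
              (mul_nonneg (hL0 P Y) (by positivity))
        _ = _ := by ring
    · rw [integral_mul_const, he, hk, hl, ← Real.exp_add, Real.exp_le_exp,
        show s0 + (2 * a + -a) = s0 + a by ring, hT]
      have h3 : -(cumulant ν (s0 + a) - cumulant ν s0) ≤ -(a * g) + K / 2 * a ^ 2 := by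
        nlinarith
      have h4 := mul_le_mul_of_nonneg_left h3 hkl
      nlinarith

end

/-! ### Summation over the overlaps -/

lemma sum_exp_mul_exp_le {N M n m : ℕ} (hn : n ≤ N) (hm : m ≤ M)
    {P : Finset (Fin N) × Finset (Fin M)} (hP : P ∈ blockIndex N M n m) {s t : ℝ} (hs : 0 ≤ s)
    (ht : 0 ≤ t) :
    ∑ Q ∈ blockIndex N M n m, Real.exp (s * (P.1 ∩ Q.1).card) * Real.exp (t * (P.2 ∩ Q.2).card) ≤
      (N.choose n : ℝ) * M.choose m * (Real.exp (n * ((n : ℝ) / N) * (Real.exp s - 1)) *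
        Real.exp (m * ((m : ℝ) / M) * (Real.exp t - 1))) := by
  rw [blockIndex, Finset.sum_product]
  simp only
  simp_rw [← Finset.mul_sum]
  rw [← Finset.sum_mul]
  refine (mul_le_mul (sum_exp_card_inter_le hn (mem_blockIndex.1 hP).1 hs)
    (sum_exp_card_inter_le hm (mem_blockIndex.1 hP).2 ht)
    (Finset.sum_nonneg fun _ _ => (Real.exp_pos _).le) (by positivity)).trans (le_of_eq ?_)
  ring

/-- The weight of a pair of submatrices is bounded by the sum of the bounds for three ranges of the
numbers of common rows and columns. -/
lemma pair_weight_le {n m κ δ η x y E k l w : ℝ} (hn : 0 < n) (hm : 0 < m) (hκ : 0 < κ)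
    (hη : 0 < η) (hη1 : η < 1) (hx : 0 ≤ x) (hy : 0 ≤ y)
    (h2 : κ * δ * n ≤ y / 2) (h3 : κ * (n * m) / 2 ≤ (1 - η) * (n * x + m * y))
    (hk0 : 0 ≤ k) (hl0 : 0 ≤ l) (hkn : k ≤ n) (hlm : l ≤ m)
    (hw1 : w ≤ Real.exp (κ * k * l))
    (hw2 : δ * n < k → δ * m < l → w ≤ Real.exp (κ * k * l / 2 + E)) :
    w ≤ (if l ≤ δ * m then Real.exp (κ * l * k) else 0) +
      Real.exp (-(y * (δ * m) / 4)) * (Real.exp (0 * k) * Real.exp (3 * y / 4 * l)) +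
      Real.exp (E - η * δ * (n * x + m * y) / 2) *
        (Real.exp ((1 - η / 2) * x * k) * Real.exp ((1 - η / 2) * y * l)) := by
  split_ifs with hlδ
  · have := hw1
    rw [show κ * k * l = κ * l * k by ring] at this
    have : 0 ≤ Real.exp (-(y * (δ * m) / 4)) * (Real.exp (0 * k) *
      Real.exp (3 * y / 4 * l)) := by positivity
    have : 0 ≤ Real.exp (E - η * δ * (n * x + m * y) / 2) *
      (Real.exp ((1 - η / 2) * x * k) * Real.exp ((1 - η / 2) * y * l)) := by positivity
    linarith
  · push Not at hlδ
    rw [zero_add]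
    rcases le_or_gt k (δ * n) with hkδ | hkδ
    · refine le_trans ?_ (le_add_of_nonneg_right (by positivity))
      refine hw1.trans ?_
      rw [← Real.exp_add, ← Real.exp_add, Real.exp_le_exp]
      -- The exponent is at most yl/2 = 3yl/4 - yl/4, and l > δm turns the last term into a
      -- prefactor.
      have e1 : κ * k * l ≤ κ * (δ * n) * l := by gcongr
      have e2 : κ * δ * n * l ≤ y / 2 * l := by gcongr
      have e3 : y * (δ * m) ≤ y * l := by gcongr
      nlinarith
    · refine le_trans ?_ (le_add_of_nonneg_left (by positivity))
      refine (hw2 hkδ hlδ).trans ?_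
      rw [← Real.exp_add, ← Real.exp_add, Real.exp_le_exp]
      -- The boundary condition, stated for k = n and l = m, is scaled by kl/(nm), with l/m ≤ 1 and
      -- k/n ≤ 1. Of the slack η(xk + yl), half is spent on the prefactor through k > δn and l > δm.
      have e1 : κ * k * l / 2 ≤ (1 - η) * (x * k + y * l) := by
        have a1 : κ * k * l / 2 = (κ * (n * m) / 2) * (k * l / (n * m)) := by field_simp
        have a2 : (κ * (n * m) / 2) * (k * l / (n * m)) ≤
            (1 - η) * (n * x + m * y) * (k * l / (n * m)) := by gcongr
        have a3 : (1 - η) * (n * x + m * y) * (k * l / (n * m)) =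
            (1 - η) * (x * k * (l / m) + y * l * (k / n)) := by field_simp
        have a4 : x * k * (l / m) ≤ x * k * 1 := by
          gcongr; rw [div_le_one hm]; exact hlm
        have a5 : y * l * (k / n) ≤ y * l * 1 := by
          gcongr; rw [div_le_one hn]; exact hkn
        have a6 : (1 - η) * (x * k * (l / m) + y * l * (k / n)) ≤
            (1 - η) * (x * k + y * l) :=
          mul_le_mul_of_nonneg_left (by linarith) (by linarith)
        linarith
      have e2 : η * x * (δ * n) ≤ η * x * k := by gcongr
      have e3 : η * y * (δ * m) ≤ η * y * l := by gcongr
      nlinarith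
lemma exp_sub_one_le_mul_exp (x : ℝ) : Real.exp x - 1 ≤ x * Real.exp x := by
  have := Real.add_one_le_exp (-x)
  have h5 : Real.exp (-x) * Real.exp x = 1 := by rw [← Real.exp_add]; simp
  nlinarith [Real.exp_pos x]

lemma exp_sub_one_le_two_mul {x : ℝ} (h0 : 0 ≤ x) (h1 : x ≤ 1) : Real.exp x - 1 ≤ 2 * x := by
  have := Real.abs_exp_sub_one_le (x := x) (by rwa [abs_of_nonneg h0])
  rw [abs_of_nonneg h0] at this
  exact (le_abs_self _).trans this

/-- For κl ≤ 1 the inner exponential is linearized. For κl > 1 the exponent is at most l by `h1`,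
and l ≤ 2l - 1/κ, which gains the tiny factor exp(-1/κ). -/
lemma exp_mul_exp_sub_one_le {c κ l L : ℝ} (hc : 0 ≤ c) (hκ : 0 < κ) (hl0 : 0 ≤ l) (hlL : l ≤ L)
    (h1 : c * κ * Real.exp (κ * L) ≤ 1) :
    Real.exp (c * (Real.exp (κ * l) - 1)) ≤
      Real.exp (2 * c * κ * l) + Real.exp (-(1 / κ)) * Real.exp (2 * l) := by
  rcases le_or_gt (κ * l) 1 with hκl | hκl
  · refine le_trans ?_ (le_add_of_nonneg_right (by positivity))
    rw [Real.exp_le_exp]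
    calc c * (Real.exp (κ * l) - 1) ≤ c * (2 * (κ * l)) :=
          mul_le_mul_of_nonneg_left (exp_sub_one_le_two_mul (by positivity) hκl) hc
      _ = 2 * c * κ * l := by ring
  · refine le_trans ?_ (le_add_of_nonneg_left (by positivity))
    rw [← Real.exp_add, Real.exp_le_exp]
    have e2 : c * (Real.exp (κ * l) - 1) ≤ l := by
      calc c * (Real.exp (κ * l) - 1) ≤ c * (κ * l * Real.exp (κ * l)) :=
            mul_le_mul_of_nonneg_left (exp_sub_one_le_mul_exp _) hc
        _ ≤ c * (κ * l * Real.exp (κ * L)) := by gcongr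
        _ = c * κ * Real.exp (κ * L) * l := by ring
        _ ≤ 1 * l := mul_le_mul_of_nonneg_right h1 hl0
        _ = l := one_mul l
    have e3 : 1 / κ ≤ l := by rw [div_le_iff₀ hκ]; linarith
    linarith

/-- The contribution of the pairs with few common columns. -/
lemma sum_few_columns_le {N M n m : ℕ} (hn : n ≤ N) (hm : m ≤ M)
    {κ δ p q : ℝ} (hκ : 0 < κ) (hp0 : 0 ≤ p) (hp : (n : ℝ) / N = p) (hq : (m : ℝ) / M = q)
    (h1 : n * p * κ * Real.exp (κ * (δ * m)) ≤ 1)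
    {P : Finset (Fin N) × Finset (Fin M)} (hP : P ∈ blockIndex N M n m) :
    ∑ Q ∈ blockIndex N M n m, (if ((P.2 ∩ Q.2).card : ℝ) ≤ δ * m then
        Real.exp (κ * (P.2 ∩ Q.2).card * (P.1 ∩ Q.1).card) else 0) ≤
      (N.choose n : ℝ) * M.choose m * (Real.exp (m * q * (Real.exp (2 * (n * p) * κ) - 1)) +
        Real.exp (-(1 / κ) + m * q * (Real.exp 2 - 1))) := by
  -- The column set is fixed first. Averaging over the row set gives an iterated exponential in l,
  -- which `exp_mul_exp_sub_one_le` makes simple enough to average over the columns.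
  rw [blockIndex, Finset.sum_product, Finset.sum_comm]
  simp only
  have hB : ∀ B ∈ (Finset.univ : Finset (Fin M)).powersetCard m,
      ∑ A ∈ (Finset.univ : Finset (Fin N)).powersetCard n,
        (if ((P.2 ∩ B).card : ℝ) ≤ δ * m then
          Real.exp (κ * (P.2 ∩ B).card * (P.1 ∩ A).card) else 0) ≤
      (N.choose n : ℝ) * (Real.exp (2 * (n * p) * κ * (P.2 ∩ B).card) +
        Real.exp (-(1 / κ)) * Real.exp (2 * (P.2 ∩ B).card)) := by
    intro B _
    set l : ℝ := ((P.2 ∩ B).card : ℝ) with hl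
    have hl0 : 0 ≤ l := by positivity
    split_ifs with hlδ
    · refine (sum_exp_card_inter_le hn (mem_blockIndex.1 hP).1 (by positivity)).trans ?_
      refine mul_le_mul_of_nonneg_left ?_ (by positivity)
      rw [hp]
      exact exp_mul_exp_sub_one_le (by positivity) hκ hl0 hlδ h1
    · rw [Finset.sum_const_zero]; positivity
  refine (Finset.sum_le_sum hB).trans ?_
  rw [← Finset.mul_sum, mul_assoc (N.choose n : ℝ)]
  refine mul_le_mul_of_nonneg_left ?_ (Nat.cast_nonneg _)
  rw [Finset.sum_add_distrib, ← Finset.mul_sum, mul_add]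
  refine add_le_add ?_ ?_
  · have := sum_exp_card_inter_le hm (mem_blockIndex.1 hP).2
      (t := 2 * (n * p) * κ) (by positivity)
    rwa [hq] at this
  · have := sum_exp_card_inter_le hm (mem_blockIndex.1 hP).2 (t := 2) (by norm_num)
    rw [hq] at this
    calc _ ≤ Real.exp (-(1 / κ)) *
          ((M.choose m : ℝ) * Real.exp (m * q * (Real.exp 2 - 1))) := by gcongr
      _ = _ := by rw [Real.exp_add]; ring

/-- Sum over the second submatrix of the bounds for the cross moments. Pairs with `δ * m` or fewer
common columns are weighted by the full second moment, and so are those with at most `δ * n` common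
rows; the remaining ones by the truncated moment. -/
lemma sum_pair_weight_le {N M n m : ℕ} (hn : n ≤ N) (hm : m ≤ M) (hn0 : 0 < n) (hm0 : 0 < m)
    {κ δ η x y E : ℝ} (hκ : 0 < κ) (hη : 0 < η) (hη1 : η < 1) (hx : 0 ≤ x)
    (hy : 0 ≤ y) (hp : (n : ℝ) / N = Real.exp (-x)) (hq : (m : ℝ) / M = Real.exp (-y))
    (h1 : n * Real.exp (-x) * κ * Real.exp (κ * (δ * m)) ≤ 1) (h2 : κ * δ * n ≤ y / 2)
    (h3 : κ * (n * m) / 2 ≤ (1 - η) * (n * x + m * y))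
    {P : Finset (Fin N) × Finset (Fin M)} (hP : P ∈ blockIndex N M n m)
    {w : Finset (Fin N) × Finset (Fin M) → ℝ}
    (hw1 : ∀ Q ∈ blockIndex N M n m, w Q ≤ Real.exp (κ * (P.1 ∩ Q.1).card * (P.2 ∩ Q.2).card))
    (hw2 : ∀ Q ∈ blockIndex N M n m, δ * n < (P.1 ∩ Q.1).card → δ * m < (P.2 ∩ Q.2).card →
      w Q ≤ Real.exp (κ * (P.1 ∩ Q.1).card * (P.2 ∩ Q.2).card / 2 + E)) :
    ∑ Q ∈ blockIndex N M n m, w Q ≤ (N.choose n : ℝ) * M.choose m *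
      (Real.exp (m * Real.exp (-y) * (Real.exp (2 * (n * Real.exp (-x)) * κ) - 1)) +
        Real.exp (-(1 / κ) + m * Real.exp (-y) * (Real.exp 2 - 1)) +
        Real.exp (-(y * (δ * m) / 4) + m * Real.exp (-(y / 4))) +
        Real.exp (E - η * δ * (n * x + m * y) / 2 + n * Real.exp (-(η * x / 2)) +
          m * Real.exp (-(η * y / 2)))) := by
  have hn' : (0 : ℝ) < n := by exact_mod_cast hn0
  have hm' : (0 : ℝ) < m := by exact_mod_cast hm0
  set CN : ℝ := ((N.choose n : ℕ) : ℝ) with hCN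
  set CM : ℝ := ((M.choose m : ℕ) : ℝ) with hCM
  set p := Real.exp (-x) with hpdef
  set q := Real.exp (-y) with hqdef
  have hp0 : 0 < p := Real.exp_pos _
  have hq0 : 0 < q := Real.exp_pos _
  set I := blockIndex N M n m with hI
  have hsplit : ∀ Q ∈ I, w Q ≤
      (if ((P.2 ∩ Q.2).card : ℝ) ≤ δ * m then
        Real.exp (κ * (P.2 ∩ Q.2).card * (P.1 ∩ Q.1).card) else 0) +
      Real.exp (-(y * (δ * m) / 4)) * (Real.exp (0 * ((P.1 ∩ Q.1).card : ℝ)) *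
        Real.exp (3 * y / 4 * ((P.2 ∩ Q.2).card : ℝ))) +
      Real.exp (E - η * δ * (n * x + m * y) / 2) *
        (Real.exp ((1 - η / 2) * x * ((P.1 ∩ Q.1).card : ℝ)) *
          Real.exp ((1 - η / 2) * y * ((P.2 ∩ Q.2).card : ℝ))) := by
    intro Q hQ
    refine pair_weight_le hn' hm' hκ hη hη1 hx hy h2 h3 (by positivity) (by positivity) ?_ ?_
      (hw1 Q hQ) (hw2 Q hQ)
    · rw [← (mem_blockIndex.1 hP).1]
      exact_mod_cast Finset.card_le_card Finset.inter_subset_left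
    · rw [← (mem_blockIndex.1 hP).2]
      exact_mod_cast Finset.card_le_card Finset.inter_subset_left
  have hA := sum_few_columns_le hn hm hκ hp0.le hp hq h1 hP
  have hB := mul_le_mul_of_nonneg_left
    (sum_exp_mul_exp_le hn hm hP (s := 0) (t := 3 * y / 4) le_rfl (by positivity))
    (Real.exp_pos (-(y * (δ * m) / 4))).le
  have hC := mul_le_mul_of_nonneg_left
    (sum_exp_mul_exp_le hn hm hP (s := (1 - η / 2) * x) (t := (1 - η / 2) * y)
      (mul_nonneg (by linarith) hx) (mul_nonneg (by linarith) hy))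
    (Real.exp_pos (E - η * δ * (n * x + m * y) / 2)).le
  rw [Finset.mul_sum] at hB hC
  refine (Finset.sum_le_sum hsplit).trans ?_
  rw [Finset.sum_add_distrib, Finset.sum_add_distrib]
  -- Since m/M = exp(-y), a tilt 3y/4 on the column overlap costs only m exp(-y/4); likewise the
  -- tilts (1 - η/2)x and (1 - η/2)y below.
  have hB' : Real.exp (-(y * (δ * m) / 4)) * (CN * CM *
      (Real.exp (n * ((n : ℝ) / N) * (Real.exp 0 - 1)) *
        Real.exp (m * ((m : ℝ) / M) * (Real.exp (3 * y / 4) - 1)))) ≤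
      CN * CM * Real.exp (-(y * (δ * m) / 4) + m * Real.exp (-(y / 4))) := by
    rw [Real.exp_zero, sub_self, mul_zero, Real.exp_zero, one_mul, mul_left_comm, ← Real.exp_add]
    refine mul_le_mul_of_nonneg_left (Real.exp_le_exp.2 (add_le_add_right ?_ _)) (by positivity)
    rw [hq, mul_assoc]
    refine mul_le_mul_of_nonneg_left ?_ hm'.le
    rw [mul_sub, mul_one, hqdef, ← Real.exp_add, show -y + 3 * y / 4 = -(y / 4) by ring]
    linarith
  have hC' : Real.exp (E - η * δ * (n * x + m * y) / 2) * (CN * CM *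
      (Real.exp (n * ((n : ℝ) / N) * (Real.exp ((1 - η / 2) * x) - 1)) *
        Real.exp (m * ((m : ℝ) / M) * (Real.exp ((1 - η / 2) * y) - 1)))) ≤
      CN * CM * Real.exp (E - η * δ * (n * x + m * y) / 2 + n * Real.exp (-(η * x / 2)) +
          m * Real.exp (-(η * y / 2))) := by
    rw [mul_left_comm, ← Real.exp_add, ← Real.exp_add, add_assoc]
    refine mul_le_mul_of_nonneg_left (Real.exp_le_exp.2 (add_le_add_right
      (add_le_add ?_ ?_) _)) (by positivity)
    · rw [hp, mul_assoc]
      refine mul_le_mul_of_nonneg_left ?_ hn'.le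
      rw [mul_sub, mul_one, hpdef, ← Real.exp_add, show -x + (1 - η / 2) * x = -(η * x / 2) by ring]
      linarith
    · rw [hq, mul_assoc]
      refine mul_le_mul_of_nonneg_left ?_ hm'.le
      rw [mul_sub, mul_one, hqdef, ← Real.exp_add, show -y + (1 - η / 2) * y = -(η * y / 2) by ring]
      linarith
  linarith [hB.trans hB', hC.trans hC']

/-! ### Limits of the error terms below the detection boundary -/

section
variable {ι : Type*} {l : Filter ι}

/-- The expression is exp(x(log y / x - 1/2)). The iterated-logarithm conditions enter the argument
here. -/
lemma tendsto_mul_exp_neg_half {x y : ι → ℝ} (hx : Tendsto x l atTop) (hy : Tendsto y l atTop)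
    (h : Tendsto (fun i => Real.log (y i) / x i) l (𝓝 0)) :
    Tendsto (fun i => y i * Real.exp (-(x i / 2))) l (𝓝 0) := by
  have h1 : Tendsto (fun i => x i * (Real.log (y i) / x i - 1 / 2)) l atBot :=
    hx.atTop_mul_neg (show (0 : ℝ) - 1 / 2 < 0 by norm_num) (h.sub_const _)
  refine (Real.tendsto_exp_atBot.comp h1).congr' ?_
  filter_upwards [hx.eventually_gt_atTop 0, hy.eventually_gt_atTop 0] with i hi hi'
  simp only [Function.comp]
  nth_rewrite 2 [← Real.exp_log hi']
  rw [← Real.exp_add]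
  congr 1
  field_simp
  ring

/-- Terms of order n lose against n log(1/p), since log(1/p) tends to infinity. -/
lemma tendsto_mul_neg_mul_add {n x u : ι → ℝ} {c u₀ : ℝ} (hn : Tendsto n l atTop)
    (hx : Tendsto x l atTop) (hc : 0 < c) (hu : Tendsto u l (𝓝 u₀)) :
    Tendsto (fun i => n i * (-(c * x i) + u i)) l atBot :=
  hn.atTop_mul_atBot₀ ((tendsto_neg_atTop_atBot.comp (hx.const_mul_atTop hc)).atBot_add hu)

lemma tendsto_exp_neg_mul {x : ι → ℝ} {c : ℝ} (hx : Tendsto x l atTop) (hc : 0 < c) :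
    Tendsto (fun i => Real.exp (-(c * x i))) l (𝓝 0) :=
  Real.tendsto_exp_atBot.comp (tendsto_neg_atTop_atBot.comp (hx.const_mul_atTop hc))

variable {N M n m : ι → ℕ} {p q : ι → ℝ}

/-- The second order condition on signals below the detection boundary, for a signal of squared
size `κ`. -/
structure BelowBoundary (l : Filter ι) (n m : ι → ℕ) (p q κ : ι → ℝ) (η C : ℝ) : Prop where
  pos : ∀ i, 0 < κ i
  le_entropy : ∀ᶠ i in l, κ i * ((n i : ℝ) * m i) / 2 ≤
    (1 - η) * entropy (n i) (m i) (p i) (q i)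
  eta_pos : 0 < η
  eta_lt : η < 1
  const_pos : 0 < C
  rows_le : ∀ᶠ i in l, (n i : ℝ) * Real.log (p i)⁻¹ ≤ C * (m i * Real.log (q i)⁻¹)
  columns_le : ∀ᶠ i in l, (m i : ℝ) * Real.log (q i)⁻¹ ≤ C * (n i * Real.log (p i)⁻¹)
  log_rows : Tendsto (fun i => Real.log (Real.log (p i)⁻¹) / Real.log (q i)⁻¹) l (𝓝 0)
  log_columns : Tendsto (fun i => Real.log (Real.log (q i)⁻¹) / Real.log (p i)⁻¹) l (𝓝 0)
  linear : Tendsto (fun i => κ i * ((n i : ℝ) * m i * p i * q i)) l (𝓝 0)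

namespace BelowBoundary

variable {κ : ι → ℝ} {η C : ℝ}

lemma swap (hb : BelowBoundary l n m p q κ η C) : BelowBoundary l m n q p κ η C where
  pos := hb.pos
  le_entropy := hb.le_entropy.mono fun i hi => by
    rw [entropy, add_comm, mul_comm (m i : ℝ)]; exact hi
  eta_pos := hb.eta_pos
  eta_lt := hb.eta_lt
  const_pos := hb.const_pos
  rows_le := hb.columns_le
  columns_le := hb.rows_le
  log_rows := hb.log_columns
  log_columns := hb.log_rows
  linear := hb.linear.congr fun i => by ring

variable (h : SparseRegime l N M n m p q) (hb : BelowBoundary l n m p q κ η C)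
include h hb

/-- Comparability of n log(1/p) and m log(1/q) bounds the entropy by (1 + C) m log(1/q); the
boundary condition is then divided by m. -/
lemma mul_rows_le : ∀ᶠ i in l, κ i * n i ≤ 2 * (1 + C) * Real.log (q i)⁻¹ := by
  filter_upwards [hb.le_entropy, hb.rows_le, h.swap.eventually_pos,
    h.tendsto_entropy.eventually_ge_atTop 0] with i h1 h2 h3 h4
  have hm : (0 : ℝ) < m i := by exact_mod_cast h3.1
  refine le_of_mul_le_mul_left ?_ hm
  have h5 : (1 - η) * entropy (n i) (m i) (p i) (q i) ≤ 1 * entropy (n i) (m i) (p i) (q i) :=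
    mul_le_mul_of_nonneg_right (by linarith [hb.eta_pos]) h4
  rw [one_mul] at h5
  have h6 : entropy (n i) (m i) (p i) (q i) ≤ (1 + C) * (m i * Real.log (q i)⁻¹) := by
    rw [entropy]; linarith
  linarith

lemma tendsto_zero : Tendsto κ l (𝓝 0) := by
  have h1 : Tendsto (fun i => 2 * (entropy (n i) (m i) (p i) (q i) / ((n i : ℝ) * m i))) l
      (𝓝 0) := by simpa using h.tendsto_entropy_div.const_mul 2
  refine squeeze_zero' (Eventually.of_forall fun i => (hb.pos i).le) ?_ h1
  filter_upwards [hb.le_entropy, h.eventually_pos, h.swap.eventually_pos,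
    h.tendsto_entropy.eventually_ge_atTop 0] with i h1 h2 h3 h4
  have hn : (0 : ℝ) < n i := by exact_mod_cast h2.1
  have hm : (0 : ℝ) < m i := by exact_mod_cast h3.1
  rw [← mul_div_assoc, le_div_iff₀ (by positivity)]
  have h5 : (1 - η) * entropy (n i) (m i) (p i) (q i) ≤ 1 * entropy (n i) (m i) (p i) (q i) :=
    mul_le_mul_of_nonneg_right (by linarith [hb.eta_pos]) h4
  linarith

/-- The exponential is √p. As κn = O(log(1/q)), the condition log log(1/q) = o(log(1/p)) is what is
needed. -/
lemma tendsto_mul_exp_half :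
    Tendsto (fun i => κ i * n i * Real.exp (-(Real.log (p i)⁻¹ / 2))) l (𝓝 0) := by
  have h1 := (tendsto_mul_exp_neg_half h.tendsto_log h.swap.tendsto_log hb.log_columns).const_mul
    (2 * (1 + C))
  rw [mul_zero] at h1
  refine squeeze_zero' (Eventually.of_forall fun i => ?_) ?_ h1
  · have := (hb.pos i).le
    positivity
  · filter_upwards [hb.mul_rows_le h] with i hi
    rw [← mul_assoc]
    gcongr

lemma tendsto_mul_prob : Tendsto (fun i => κ i * n i * p i) l (𝓝 0) := by
  refine squeeze_zero' ?_ ?_ (hb.tendsto_mul_exp_half h)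
  · filter_upwards [h.eventually_pos] with i hi
    have := (hb.pos i).le
    have := hi.2.2.1.le
    positivity
  · filter_upwards [h.eventually_pos] with i hi
    have h1 := (hb.pos i).le
    have h2 := hi.2.2.1
    refine mul_le_mul_of_nonneg_left ?_ (by positivity)
    have h3 : p i = Real.exp (-Real.log (p i)⁻¹) := by
      rw [Real.log_inv, neg_neg, Real.exp_log h2]
    nth_rewrite 1 [h3]
    rw [Real.exp_le_exp]
    have : 0 ≤ Real.log (p i)⁻¹ := Real.log_nonneg ((one_le_inv₀ h2).2 hi.2.2.2.le)
    linarith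

/-- The main term: as κnp → 0, the exponent is eventually at most 4κnmpq, which vanishes by the
linear condition. -/
lemma tendsto_first : Tendsto (fun i => Real.exp (m i * q i *
    (Real.exp (2 * (n i * p i) * κ i) - 1))) l (𝓝 1) := by
  have h0 := Real.continuous_exp.tendsto 0
  rw [Real.exp_zero] at h0
  refine h0.comp ?_
  have h1 := hb.linear.const_mul 4
  rw [mul_zero] at h1
  have h2 := (hb.tendsto_mul_prob h).const_mul 2
  rw [mul_zero] at h2
  refine squeeze_zero' ?_ ?_ h1
  · filter_upwards [h.eventually_pos, h.swap.eventually_pos] with i h3 h4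
    have := (hb.pos i).le
    have := h3.2.2.1.le
    have := h4.2.2.1.le
    refine mul_nonneg (by positivity) (sub_nonneg.2 (Real.one_le_exp (by positivity)))
  · filter_upwards [h.eventually_pos, h.swap.eventually_pos,
      h2.eventually_lt_const one_pos] with i h3 h4 h5
    have := (hb.pos i).le
    have := h3.2.2.1.le
    have := h4.2.2.1.le
    calc m i * q i * (Real.exp (2 * (n i * p i) * κ i) - 1)
        ≤ m i * q i * (2 * (2 * (n i * p i) * κ i)) :=
          mul_le_mul_of_nonneg_left (exp_sub_one_le_two_mul (by positivity)
            (by linarith)) (by positivity)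
      _ = 4 * (κ i * (n i * m i * p i * q i)) := by ring

/-- Multiplied by κ, the exponent tends to -1, because κmq → 0; and κ → 0. -/
lemma tendsto_second : Tendsto (fun i => Real.exp (-(1 / κ i) +
    m i * q i * (Real.exp 2 - 1))) l (𝓝 0) := by
  refine Real.tendsto_exp_atBot.comp ?_
  have h1 : Tendsto (fun i => (κ i)⁻¹) l atTop := Tendsto.inv_tendsto_nhdsGT_zero
    (tendsto_nhdsWithin_iff.2 ⟨hb.tendsto_zero h, Eventually.of_forall hb.pos⟩)
  have h2 : Tendsto (fun i => -1 + κ i * m i * q i * (Real.exp 2 - 1)) l (𝓝 (-1 + 0 * _)) :=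
    ((hb.swap.tendsto_mul_prob h.swap).mul_const (Real.exp 2 - 1)).const_add (-1)
  refine (h1.atTop_mul_neg (by simp) h2).congr fun i => ?_
  have := (hb.pos i).ne'
  field_simp

omit hb in
lemma tendsto_third {δ : ℝ} (hδ : 0 < δ) : Tendsto (fun i => Real.exp
    (-(Real.log (q i)⁻¹ * (δ * m i) / 4) + m i * Real.exp (-(Real.log (q i)⁻¹ / 4)))) l
    (𝓝 0) := by
  refine Real.tendsto_exp_atBot.comp ?_
  refine (tendsto_mul_neg_mul_add h.swap.tendsto_cast h.swap.tendsto_log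
    (show 0 < δ / 4 by positivity) (tendsto_exp_neg_mul h.swap.tendsto_log
      (show (0 : ℝ) < 1 / 4 by norm_num))).congr fun i => ?_
  rw [show -(Real.log (q i)⁻¹ / 4) = -(1 / 4 * Real.log (q i)⁻¹) by ring]
  ring

/-- Of the gain ηδ/2 times the entropy, `E` uses at most half, and the rest dominates the terms o(n)
and o(m). -/
lemma tendsto_fourth {δ : ℝ} (hδ : 0 < δ) {E : ι → ℝ}
    (hE : ∀ᶠ i in l, E i ≤ η * δ / 4 * entropy (n i) (m i) (p i) (q i)) :
    Tendsto (fun i => Real.exp (E i - η * δ * (n i * Real.log (p i)⁻¹ + m i * Real.log (q i)⁻¹) / 2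
      + n i * Real.exp (-(η * Real.log (p i)⁻¹ / 2)) +
      m i * Real.exp (-(η * Real.log (q i)⁻¹ / 2)))) l (𝓝 0) := by
  have hη := hb.eta_pos
  refine Real.tendsto_exp_atBot.comp ?_
  have h1 := tendsto_mul_neg_mul_add h.tendsto_cast h.tendsto_log
    (show 0 < η * δ / 4 by positivity) (tendsto_exp_neg_mul h.tendsto_log
      (show (0 : ℝ) < η / 2 by positivity))
  have h2 := tendsto_mul_neg_mul_add h.swap.tendsto_cast h.swap.tendsto_log
    (show 0 < η * δ / 4 by positivity) (tendsto_exp_neg_mul h.swap.tendsto_log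
      (show (0 : ℝ) < η / 2 by positivity))
  refine tendsto_atBot_mono' l ?_ (h1.atBot_add_atBot h2)
  filter_upwards [hE] with i hi
  rw [entropy] at hi
  rw [show -(η * Real.log (p i)⁻¹ / 2) = -(η / 2 * Real.log (p i)⁻¹) by ring,
    show -(η * Real.log (q i)⁻¹ / 2) = -(η / 2 * Real.log (q i)⁻¹) by ring]
  linarith

end BelowBoundary

/-- The number 2^(n+m) of blocks in the union bound has logarithm of order n + m, negligible against
the entropy. -/
lemma SparseRegime.tendsto_truncation (h : SparseRegime l N M n m p q) {c : ℝ} (hc : 0 < c) :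
    Tendsto (fun i => (2 : ℝ) ^ n i * 2 ^ m i *
      Real.exp (-(c * entropy (n i) (m i) (p i) (q i)))) l (𝓝 0) := by
  have h1 := tendsto_mul_neg_mul_add h.tendsto_cast h.tendsto_log hc
    (tendsto_const_nhds (x := Real.log 2))
  have h2 := tendsto_mul_neg_mul_add h.swap.tendsto_cast h.swap.tendsto_log hc
    (tendsto_const_nhds (x := Real.log 2))
  refine (Real.tendsto_exp_atBot.comp (h1.atBot_add_atBot h2)).congr fun i => ?_
  have e : ∀ k : ℕ, (2 : ℝ) ^ k = Real.exp (k * Real.log 2) := fun k => by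
    rw [Real.exp_nat_mul, Real.exp_log two_pos]
  rw [e, e, ← Real.exp_add, ← Real.exp_add, entropy]
  simp only [Function.comp]
  congr 1
  ring

end

/-- Below the detection boundary the maximal type II error of every test exceeds the trivial bound
up to an error that tends to zero uniformly over all tests. -/
theorem eventually_one_sub_le_maxTypeTwoError {ν : Measure ℝ} [NeZero ν] {D : Set ℝ}
    (hD : D ⊆ naturalSpace ν) {s0 : ℝ} (hs0 : s0 ∈ interior D)
    (hA2 : iteratedDeriv 2 (cumulant ν) s0 = 1)
    {ι : Type*} {l : Filter ι} {N M n m : ι → ℕ} {p q a : ι → ℝ} (ha : ∀ i, 0 < a i)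
    (h : SparseRegime l N M n m p q) {K η C : ℝ} (hK : 1 < K)
    (hb : BelowBoundary l n m p q (fun i => K * a i ^ 2) η C) {ε : ℝ} (hε : 0 < ε) :
    ∀ᶠ i in l, ∀ ψ : (Fin (N i) × Fin (M i) → ℝ) → ℝ, IsTest ψ →
      1 - typeOneError ν s0 ψ - ε ≤ maxTypeTwoError ν D s0 (n i) (m i) (a i) ψ := by
  have hs0' : s0 ∈ interior (naturalSpace ν) := interior_mono hD hs0
  obtain ⟨ρ, hρ, hQ⟩ := exists_quadraticBound hs0' hA2 hK
  have hη := hb.eta_pos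
  have hη1 := hb.eta_lt
  have hC := hb.const_pos
  -- By `mul_rows_le` and its mirror image, this δ gives κδn ≤ log(1/q)/2 and κδm ≤ log(1/p)/2.
  set δ : ℝ := (4 * (1 + C))⁻¹ with hδ
  have hδ0 : 0 < δ := by positivity
  have hδC : 2 * (1 + C) * δ = 1 / 2 := by rw [hδ]; field_simp; norm_num
  -- The deviation d = τ√R must outweigh the union bound, for which any fixed τ > 0 suffices, while
  -- its cost E ≤ 2τR must stay within ηδR/4.
  set τ : ℝ := η * δ / 8 with hτ
  have hτ0 : 0 < τ := by positivity
  set κ : ι → ℝ := fun i => K * a i ^ 2 with hκ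
  set R : ι → ℝ := fun i => entropy (n i) (m i) (p i) (q i) with hR
  set d : ι → ℝ := fun i => τ * √(R i) with hd
  set E : ι → ℝ := fun i => a i * √((n i : ℝ) * m i) * d i with hE
  -- the signal tends to zero
  have ha0 : Tendsto a l (𝓝 0) := by
    have h1 : Tendsto (fun i => √(κ i)) l (𝓝 0) := by
      have := (hb.tendsto_zero h).sqrt
      rwa [Real.sqrt_zero] at this
    refine squeeze_zero (fun i => (ha i).le) (fun i => ?_) h1
    exact Real.le_sqrt_of_sq_le (le_mul_of_one_le_left (sq_nonneg _) hK.le)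
  have haD : ∀ᶠ i in l, s0 + a i ∈ D := by
    have h1 : Tendsto (fun i => s0 + a i) l (𝓝 s0) := by simpa using ha0.const_add s0
    exact h1.eventually (mem_interior_iff_mem_nhds.1 hs0)
  -- the threshold deviations are small
  have hdρ : ∀ᶠ i in l, d i / (K * (δ * √((n i : ℝ) * m i))) ≤ ρ / 2 := by
    have h1 : Tendsto (fun i => τ / (K * δ) * √(R i / ((n i : ℝ) * m i))) l (𝓝 0) := by
      have := h.tendsto_entropy_div.sqrt.const_mul (τ / (K * δ))
      rwa [Real.sqrt_zero, mul_zero] at this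
    filter_upwards [h1.eventually_lt_const (half_pos hρ)] with i hi
    refine le_trans (le_of_eq ?_) hi.le
    rw [Real.sqrt_div' _ (by positivity), hd]
    have : K ≠ 0 := by positivity
    field_simp
  have hER : ∀ᶠ i in l, E i ≤ η * δ / 4 * R i := by
    filter_upwards [hb.le_entropy, h.tendsto_entropy.eventually_ge_atTop 0] with i h1 h2
    change 0 ≤ R i at h2
    change K * a i ^ 2 * ((n i : ℝ) * m i) / 2 ≤ (1 - η) * R i at h1
    have h3 : a i * √((n i : ℝ) * m i) ≤ 2 * √(R i) := by
      refine abs_le_of_sq_le_sq' ?_ (by positivity) |>.2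
      rw [mul_pow, mul_pow, Real.sq_sqrt (by positivity), Real.sq_sqrt h2]
      have h4 : 0 ≤ a i ^ 2 * ((n i : ℝ) * m i) := by positivity
      nlinarith
    calc E i = a i * √((n i : ℝ) * m i) * (τ * √(R i)) := rfl
      _ ≤ 2 * √(R i) * (τ * √(R i)) := by gcongr
      _ = 2 * τ * (√(R i) ^ 2) := by ring
      _ = η * δ / 4 * R i := by rw [Real.sq_sqrt h2, hτ]; ring
  -- the two error terms
  have ht1 := h.tendsto_truncation (show 0 < τ ^ 2 / (2 * K) by positivity)
  have ht2 := (((hb.tendsto_first h).add (hb.tendsto_second h)).add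
    (BelowBoundary.tendsto_third h hδ0)).add (hb.tendsto_fourth h hδ0 hER)
  have ht3 := (ht2.sub_const 1).add (ht1.const_mul 2)
  simp only [add_zero, mul_zero, sub_self] at ht3
  -- the condition on the exponential moments
  have hsmall : ∀ᶠ i in l, (n i : ℝ) * p i * κ i * Real.exp (κ i * (δ * m i)) ≤ 1 := by
    filter_upwards [h.eventually_pos, hb.swap.mul_rows_le h.swap,
      (hb.tendsto_mul_exp_half h).eventually_lt_const one_pos] with i h1 h2 h3
    refine le_trans ?_ h3.le
    have h4 : p i = Real.exp (-Real.log (p i)⁻¹) := by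
      rw [Real.log_inv, neg_neg, Real.exp_log h1.2.2.1]
    have h5 : κ i * (δ * m i) ≤ Real.log (p i)⁻¹ / 2 := by
      calc κ i * (δ * m i) = δ * (κ i * m i) := by ring
        _ ≤ δ * (2 * (1 + C) * Real.log (p i)⁻¹) := by gcongr
        _ = 2 * (1 + C) * δ * Real.log (p i)⁻¹ := by ring
        _ = Real.log (p i)⁻¹ / 2 := by rw [hδC]; ring
    have h6 : p i * Real.exp (κ i * (δ * m i)) ≤ Real.exp (-(Real.log (p i)⁻¹ / 2)) := by
      nth_rewrite 1 [h4]
      rw [← Real.exp_add, Real.exp_le_exp]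
      linarith
    calc (n i : ℝ) * p i * κ i * Real.exp (κ i * (δ * m i))
        = κ i * n i * (p i * Real.exp (κ i * (δ * m i))) := by ring
      _ ≤ κ i * n i * Real.exp (-(Real.log (p i)⁻¹ / 2)) :=
        mul_le_mul_of_nonneg_left h6 (mul_nonneg (hb.pos i).le (Nat.cast_nonneg _))
  filter_upwards [h.eventually_pos, h.swap.eventually_pos, haD, hdρ, hsmall, hb.mul_rows_le h,
    hb.le_entropy, ht3.eventually_lt_const (show 0 < ε ^ 2 by positivity),
    ha0.eventually_lt_const (half_pos hρ), h.tendsto_entropy.eventually_gt_atTop 0]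
    with i hN hM hDi hdi hsi hκn hκR hεi hai hRi ψ hψ
  change 0 < R i at hRi
  have hd0 : 0 < d i := mul_pos hτ0 (Real.sqrt_pos.2 hRi)
  have hx : 0 ≤ Real.log (p i)⁻¹ := Real.log_nonneg ((one_le_inv₀ hN.2.2.1).2 hN.2.2.2.le)
  have hy : 0 ≤ Real.log (q i)⁻¹ := Real.log_nonneg ((one_le_inv₀ hM.2.2.1).2 hM.2.2.2.le)
  have hpx : Real.exp (-Real.log (p i)⁻¹) = p i := by
    rw [Real.log_inv, neg_neg, Real.exp_log hN.2.2.1]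
  have hqy : Real.exp (-Real.log (q i)⁻¹) = q i := by
    rw [Real.log_inv, neg_neg, Real.exp_log hM.2.2.1]
  have hpair : ∀ P ∈ blockIndex (N i) (M i) (n i) (m i),
      ∑ Q ∈ blockIndex (N i) (M i) (n i) (m i),
        ∫ Y, (likelihood ν s0 (planted s0 (a i) P) Y *
            truncationWeight ν s0 (a i) δ (d i) (n i) (m i) P Y) *
          (likelihood ν s0 (planted s0 (a i) Q) Y *
            truncationWeight ν s0 (a i) δ (d i) (n i) (m i) Q Y) ∂nullLaw ν s0 (N i) (M i) ≤ _ :=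
    fun P hP => sum_pair_weight_le hN.2.1 hM.2.1 hN.1 hM.1 (κ := κ i) (δ := δ) (η := η)
      (x := Real.log (p i)⁻¹) (y := Real.log (q i)⁻¹) (E := E i) (hb.pos i) hη hη1 hx hy
      (by rw [hpx, h.hp]) (by rw [hqy, h.hq]) (by rw [hpx]; exact hsi)
      (by
        calc κ i * δ * n i = δ * (κ i * n i) := by ring
          _ ≤ δ * (2 * (1 + C) * Real.log (q i)⁻¹) := mul_le_mul_of_nonneg_left hκn hδ0.le
          _ = 2 * (1 + C) * δ * Real.log (q i)⁻¹ := by ring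
          _ = Real.log (q i)⁻¹ / 2 := by rw [hδC]; ring)
      hκR hP (fun Q _ => (integral_truncated_mul_le hQ (ha i) hai.le P Q rfl rfl).1)
      fun Q _ h1 h2 => ((integral_truncated_mul_le hQ (ha i) hai.le P Q rfl rfl).2 h1 h2).trans
        (Real.exp_le_exp.2 (add_le_add_right (by
          have hk : ((P.1 ∩ Q.1).card : ℝ) ≤ n i := by
            rw [← (mem_blockIndex.1 hP).1]
            exact_mod_cast Finset.card_le_card Finset.inter_subset_left
          have hl : ((P.2 ∩ Q.2).card : ℝ) ≤ m i := by
            rw [← (mem_blockIndex.1 hP).2]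
            exact_mod_cast Finset.card_le_card Finset.inter_subset_left
          have := (ha i).le
          simp only [hE]
          gcongr) _))
  rw [hpx, hqy] at hpair
  -- Θ stands for the four-term bound in `hpair`; then η₂ = Θ - 1, and η₁ is the truncation error.
  have key : ∀ Θ : ℝ, Θ - 1 + 2 * ((2 : ℝ) ^ n i * 2 ^ m i *
      Real.exp (-(τ ^ 2 / (2 * K) * R i))) < ε ^ 2 → (∀ P ∈ blockIndex (N i) (M i) (n i) (m i),
      ∑ Q ∈ blockIndex (N i) (M i) (n i) (m i),
        ∫ Y, (likelihood ν s0 (planted s0 (a i) P) Y *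
            truncationWeight ν s0 (a i) δ (d i) (n i) (m i) P Y) *
          (likelihood ν s0 (planted s0 (a i) Q) Y *
            truncationWeight ν s0 (a i) δ (d i) (n i) (m i) Q Y) ∂nullLaw ν s0 (N i) (M i) ≤
        ((N i).choose (n i) : ℝ) * (M i).choose (m i) * Θ) →
      1 - typeOneError ν s0 ψ - ε ≤ maxTypeTwoError ν D s0 (n i) (m i) (a i) ψ := by
    intro Θ hΘ hP
    refine one_sub_le_maxTypeTwoError (η₂ := Θ - 1) hD (interior_subset hs0) hDi
      (hQ _ ⟨by linarith [ha i], by linarith⟩).1 hN.2.1 hM.2.1 measurable_truncationWeight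
      truncationWeight_mem (fun P hP => integral_one_sub_truncationWeight_le hQ (by linarith) hδ0
        hd0 (ha i) hai.le hN.1 hM.1 hdi hP)
      ((Finset.sum_le_card_nsmul _ _ _ hP).trans (le_of_eq ?_)) hε (le_trans ?_ hΘ.le) hψ
    · rw [nsmul_eq_mul, card_blockIndex, add_sub_cancel]
      ring
    · refine add_le_add le_rfl (le_of_eq ?_)
      have : d i ^ 2 / (2 * K) = τ ^ 2 / (2 * K) * R i := by
        simp only [hd]
        rw [mul_pow, Real.sq_sqrt hRi.le]
        ring
      rw [this]
  exact key _ hεi hpair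

/-! ### Passage to the minimax risks -/

section
variable {ν : Measure ℝ} {D : Set ℝ} {s0 a : ℝ} {N M n m : ℕ}

/-- For the zero measure the convention log 0 = 0 makes the cumulant function constant,
contradicting A''(s0) = 1. -/
lemma neZero_of_iteratedDeriv_cumulant (hA2 : iteratedDeriv 2 (cumulant ν) s0 = 1) : NeZero ν := by
  refine ⟨fun hν => ?_⟩
  have h : cumulant ν = fun _ => 0 := by
    funext s
    simp [cumulant, hν]
  rw [h, iteratedDeriv_const] at hA2
  simp at hA2

lemma isTest_const {c : ℝ} (h0 : 0 ≤ c) (h1 : c ≤ 1) :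
    IsTest (fun _ : Fin N × Fin M → ℝ => c) :=
  ⟨measurable_const, fun _ => ⟨h0, h1⟩⟩

variable [NeZero ν]

lemma typeOneError_const (hs0 : s0 ∈ naturalSpace ν) (c : ℝ) :
    typeOneError ν s0 (fun _ : Fin N × Fin M → ℝ => c) = c := by
  have : IsProbabilityMeasure (nullLaw ν s0 N M) := isProbabilityMeasure_matrixLaw fun _ => hs0
  simp [typeOneError]

lemma maxTypeTwoError_const_le (hD : D ⊆ naturalSpace ν) {c : ℝ} (h1 : c ≤ 1) :
    maxTypeTwoError ν D s0 n m a (fun _ : Fin N × Fin M → ℝ => c) ≤ 1 - c := by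
  refine Real.iSup_le (fun S => ?_) (by linarith)
  have := isProbabilityMeasure_matrixLaw fun ij => hD (S.2.1 ij)
  simp [typeTwoError]

omit [NeZero ν] in
lemma minimaxGlobalError_le {ψ : (Fin N × Fin M → ℝ) → ℝ} (hψ : IsTest ψ) :
    minimaxGlobalError ν D s0 N M n m a ≤ globalError ν D s0 n m a ψ := by
  refine ciInf_le (f := fun ψ : {ψ : (Fin N × Fin M → ℝ) → ℝ // IsTest ψ} =>
    globalError ν D s0 n m a ψ.1) ⟨0, ?_⟩ ⟨ψ, hψ⟩
  rintro _ ⟨φ, rfl⟩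
  exact add_nonneg (integral_nonneg fun Y => (φ.2.2 Y).1)
    (maxTypeTwoError_nonneg fun Y => (φ.2.2 Y).2)

omit [NeZero ν] in
lemma minimaxTypeTwoError_le {α : ℝ} {ψ : (Fin N × Fin M → ℝ) → ℝ} (hψ : IsTest ψ)
    (hα : typeOneError ν s0 ψ ≤ α) :
    minimaxTypeTwoError ν D s0 N M n m a α ≤ maxTypeTwoError ν D s0 n m a ψ := by
  refine ciInf_le (f := fun ψ : {ψ : (Fin N × Fin M → ℝ) → ℝ //
    IsTest ψ ∧ typeOneError ν s0 ψ ≤ α} => maxTypeTwoError ν D s0 n m a ψ.1) ⟨0, ?_⟩ ⟨ψ, hψ, hα⟩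
  rintro _ ⟨φ, rfl⟩
  exact maxTypeTwoError_nonneg fun Y => (φ.2.1.2 Y).2

end

section
variable {ν : Measure ℝ} [NeZero ν] {D : Set ℝ} {s0 : ℝ}
  {ι : Type*} {l : Filter ι} {N M n m : ι → ℕ} {a : ι → ℝ}

/-- The hypothesis is uniform over tests, so it passes to the infimum; the test that never rejects
gives the matching upper bound. -/
lemma tendsto_minimaxGlobalError (hD : D ⊆ naturalSpace ν) (hs0 : s0 ∈ naturalSpace ν)
    (h : ∀ ε > 0, ∀ᶠ i in l, ∀ ψ : (Fin (N i) × Fin (M i) → ℝ) → ℝ, IsTest ψ →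
      1 - typeOneError ν s0 ψ - ε ≤ maxTypeTwoError ν D s0 (n i) (m i) (a i) ψ) :
    Tendsto (fun i => minimaxGlobalError ν D s0 (N i) (M i) (n i) (m i) (a i)) l (𝓝 1) := by
  refine tendsto_order.2 ⟨fun c hc => ?_, fun c hc => Eventually.of_forall fun i => ?_⟩
  · filter_upwards [h ((1 - c) / 2) (by linarith)] with i hi
    have : Nonempty {ψ : (Fin (N i) × Fin (M i) → ℝ) → ℝ // IsTest ψ} :=
      ⟨⟨_, isTest_const le_rfl zero_le_one⟩⟩
    refine lt_of_lt_of_le (show c < 1 - (1 - c) / 2 by linarith) (le_ciInf fun ψ => ?_)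
    have := hi ψ.1 ψ.2
    rw [globalError]
    linarith
  · refine ((minimaxGlobalError_le (isTest_const le_rfl zero_le_one)).trans ?_).trans_lt hc
    rw [globalError, typeOneError_const hs0, zero_add]
    exact (maxTypeTwoError_const_le hD zero_le_one).trans (by norm_num)

/-- Here the constant test α has level α and attains the bound 1 - α. -/
lemma tendsto_minimaxTypeTwoError (hD : D ⊆ naturalSpace ν) (hs0 : s0 ∈ naturalSpace ν)
    (h : ∀ ε > 0, ∀ᶠ i in l, ∀ ψ : (Fin (N i) × Fin (M i) → ℝ) → ℝ, IsTest ψ →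
      1 - typeOneError ν s0 ψ - ε ≤ maxTypeTwoError ν D s0 (n i) (m i) (a i) ψ)
    {α : ℝ} (hα0 : 0 < α) (hα1 : α < 1) :
    Tendsto (fun i => minimaxTypeTwoError ν D s0 (N i) (M i) (n i) (m i) (a i) α) l
      (𝓝 (1 - α)) := by
  refine tendsto_order.2 ⟨fun c hc => ?_, fun c hc => Eventually.of_forall fun i => ?_⟩
  · filter_upwards [h ((1 - α - c) / 2) (by linarith)] with i hi
    have : Nonempty {ψ : (Fin (N i) × Fin (M i) → ℝ) → ℝ //
        IsTest ψ ∧ typeOneError ν s0 ψ ≤ α} :=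
      ⟨⟨_, isTest_const hα0.le hα1.le, (typeOneError_const hs0 α).le⟩⟩
    refine lt_of_lt_of_le (show c < 1 - α - (1 - α - c) / 2 by linarith) (le_ciInf fun ψ => ?_)
    have := hi ψ.1 ψ.2.1
    linarith [ψ.2.2]
  · exact ((minimaxTypeTwoError_le (isTest_const hα0.le hα1.le)
      (typeOneError_const hs0 α).le).trans (maxTypeTwoError_const_le hD hα1.le)).trans_lt hc

/-- Squaring gives a²nm ≤ 2b²R with R the entropy. One factor b pays for the curvature K = 1/b > 1,
the other is the slack 1 - η = b. -/
lemma belowBoundary_of_eventually_lt {p q : ι → ℝ} (h : SparseRegime l N M n m p q)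
    (ha : ∀ i, 0 < a i) {b : ℝ} (hb0 : 0 < b) (hb1 : b < 1)
    (hb : ∀ᶠ i in l, a i * √((n i : ℝ) * m i) / √(2 * entropy (n i) (m i) (p i) (q i)) < b)
    (hlog1 : Tendsto (fun i => Real.log (Real.log (p i)⁻¹) / Real.log (q i)⁻¹) l (𝓝 0))
    (hlog2 : Tendsto (fun i => Real.log (Real.log (q i)⁻¹) / Real.log (p i)⁻¹) l (𝓝 0))
    (hΘ : (fun i => (n i : ℝ) * Real.log (p i)⁻¹) =Θ[l] (fun i => (m i : ℝ) * Real.log (q i)⁻¹))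
    (hlin : Tendsto (fun i => a i * √(n i * m i * p i * q i)) l (𝓝 0)) :
    ∃ C, BelowBoundary l n m p q (fun i => b⁻¹ * a i ^ 2) (1 - b) C := by
  obtain ⟨C₁, hC₁, h1⟩ := hΘ.1.exists_pos
  obtain ⟨C₂, hC₂, h2⟩ := hΘ.2.exists_pos
  have hpos : ∀ᶠ i in l, 0 ≤ (n i : ℝ) * Real.log (p i)⁻¹ ∧ 0 ≤ (m i : ℝ) * Real.log (q i)⁻¹ := by
    filter_upwards [h.tendsto_log.eventually_ge_atTop 0,
      h.swap.tendsto_log.eventually_ge_atTop 0] with i h3 h4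
    exact ⟨by positivity, by positivity⟩
  refine ⟨max C₁ C₂, fun i => ?_, ?_, by linarith, by linarith, lt_max_of_lt_left hC₁, ?_, ?_,
    hlog1, hlog2, ?_⟩
  · have := ha i
    positivity
  · filter_upwards [hb, h.tendsto_entropy.eventually_gt_atTop 0] with i h3 h4
    rw [div_lt_iff₀ (Real.sqrt_pos.2 (by positivity))] at h3
    have h5 := pow_le_pow_left₀ (mul_nonneg (ha i).le (Real.sqrt_nonneg _)) h3.le 2
    rw [mul_pow, mul_pow, Real.sq_sqrt (by positivity), Real.sq_sqrt (by positivity)] at h5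
    rw [sub_sub_cancel, mul_assoc, inv_mul_eq_div, div_div, div_le_iff₀ (by positivity)]
    linarith
  · filter_upwards [h1.bound, hpos] with i h3 h4
    rw [Real.norm_of_nonneg h4.1, Real.norm_of_nonneg h4.2] at h3
    exact h3.trans (mul_le_mul_of_nonneg_right (le_max_left _ _) h4.2)
  · filter_upwards [h2.bound, hpos] with i h3 h4
    rw [Real.norm_of_nonneg h4.1, Real.norm_of_nonneg h4.2] at h3
    exact h3.trans (mul_le_mul_of_nonneg_right (le_max_right _ _) h4.1)
  · have h3 := (hlin.pow 2).const_mul b⁻¹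
    rw [zero_pow two_ne_zero, mul_zero] at h3
    refine h3.congr' ?_
    filter_upwards [h.eventually_pos, h.swap.eventually_pos] with i h4 h5
    have := h4.2.2.1.le
    have := h5.2.2.1.le
    rw [mul_pow, Real.sq_sqrt (by positivity)]
    ring

end

end SubmatrixDetection

theorem theorem6
    (ν : Measure ℝ) (D : Set ℝ) (hD : D ⊆ naturalSpace ν)
    (s0 : ℝ) (hs0 : s0 ∈ interior D)
    (hA1 : deriv (cumulant ν) s0 = 0) (hA2 : iteratedDeriv 2 (cumulant ν) s0 = 1)
    {ι : Type*} (l : Filter ι) (N M n m : ι → ℕ) (a : ι → ℝ) (ha : ∀ i, 0 < a i)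
    (p q : ι → ℝ) (hp : ∀ i, p i = (n i : ℝ) / N i) (hq : ∀ i, q i = (m i : ℝ) / M i)
    (hN : Tendsto N l atTop) (hM : Tendsto M l atTop)
    (hn : Tendsto n l atTop) (hm : Tendsto m l atTop)
    (hp0 : Tendsto p l (𝓝 0)) (hq0 : Tendsto q l (𝓝 0))
    (htend : Tendsto (fun i => Real.log (p i)⁻¹ / m i + Real.log (q i)⁻¹ / n i) l (𝓝 0)) :
    -- Upper bounds; the derivative of the cumulant function at `s0 + a` is meant to exist.
    ((∀ᶠ i in l, s0 + a i ∈ interior (naturalSpace ν)) →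
      -- under the first condition
      ((Tendsto (fun i => deriv (cumulant ν) (s0 + a i) * √(n i * m i * p i * q i)) l atTop →
          ∃ δ₀ > (0 : ℝ), ∀ δ : ℝ, 0 < δ → δ < δ₀ →
            ∀ c : ℝ, 0 < c → c < 1 → ∀ H : ι → ℝ, Tendsto H l atTop →
              (∀ᶠ i in l,
                H i < c * (deriv (cumulant ν) (s0 + a i) * √(n i * m i * p i * q i))) →
              Tendsto (fun i => globalError ν D s0 (n i) (m i) (a i)
                (combinedTest δ (H i) (N i) (M i) (n i) (m i))) l (𝓝 0)) ∧
      -- under the second condition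
        (1 < liminf (fun i => ((deriv (cumulant ν) (s0 + a i) * √((n i : ℝ) * m i) /
              √(2 * (n i * Real.log (p i)⁻¹ + m i * Real.log (q i)⁻¹)) : ℝ) : EReal)) l →
          ∃ δ₀ > (0 : ℝ), ∀ δ : ℝ, 0 < δ → δ < δ₀ →
            ∀ H : ι → ℝ, Tendsto H l atTop →
              Tendsto (fun i => globalError ν D s0 (n i) (m i) (a i)
                (combinedTest δ (H i) (N i) (M i) (n i) (m i))) l (𝓝 0)))) ∧
    -- Lower bounds
    (Tendsto (fun i => Real.log (Real.log (p i)⁻¹) / Real.log (q i)⁻¹) l (𝓝 0) →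
      Tendsto (fun i => Real.log (Real.log (q i)⁻¹) / Real.log (p i)⁻¹) l (𝓝 0) →
      (fun i => (n i : ℝ) * Real.log (p i)⁻¹) =Θ[l] (fun i => (m i : ℝ) * Real.log (q i)⁻¹) →
      Tendsto (fun i => a i * √(n i * m i * p i * q i)) l (𝓝 0) →
      limsup (fun i => ((a i * √((n i : ℝ) * m i) /
          √(2 * (n i * Real.log (p i)⁻¹ + m i * Real.log (q i)⁻¹)) : ℝ) : EReal)) l < 1 →
      Tendsto (fun i => minimaxGlobalError ν D s0 (N i) (M i) (n i) (m i) (a i)) l (𝓝 1) ∧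
        ∀ α : ℝ, 0 < α → α < 1 →
          Tendsto (fun i => minimaxTypeTwoError ν D s0 (N i) (M i) (n i) (m i) (a i) α) l
            (𝓝 (1 - α))) := by
  have hν : NeZero ν := neZero_of_iteratedDeriv_cumulant hA2
  have h : SparseRegime l N M n m p q := ⟨hp, hq, hN, hM, hn, hm, hp0, hq0, htend⟩
  have hs0' : s0 ∈ interior (naturalSpace ν) := interior_mono hD hs0
  refine ⟨fun _ => ⟨fun hlim => ⟨1, one_pos, fun δ hδ _ c _ hc1 H hH hHc =>
    tendsto_globalError_of_linear h hD hs0' hA1 hA2 ha hlim hδ hc1 hH hHc⟩, fun hlim => ?_⟩,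
    fun hlog1 hlog2 hΘ hlin hlim => ?_⟩
  · obtain ⟨b, hb1, hb2⟩ := EReal.lt_iff_exists_real_btwn.1 hlim
    have hb1' : 1 < b := by exact_mod_cast hb1
    -- The condition δ < b² - 1 is equivalent to √(1 + δ) < b.
    refine ⟨b ^ 2 - 1, by nlinarith, fun δ hδ hδb H hH =>
      tendsto_globalError_of_scan h hD hs0' hA1 hA2 ha hb1' ?_ hδ (by linarith) hH⟩
    filter_upwards [eventually_lt_of_lt_liminf hb2] with i hi
    exact EReal.coe_lt_coe_iff.1 hi
  · obtain ⟨b, hb1, hb2⟩ := EReal.lt_iff_exists_real_btwn.1 hlim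
    have hb2' : b < 1 := by exact_mod_cast hb2
    -- The maximum with 1/2 keeps the bound positive, so that its inverse can serve as the curvature
    -- K > 1.
    have hb : ∀ᶠ i in l, a i * √((n i : ℝ) * m i) / √(2 * entropy (n i) (m i) (p i) (q i)) <
        max b (1 / 2) := by
      filter_upwards [eventually_lt_of_limsup_lt hb1] with i hi
      exact (EReal.coe_lt_coe_iff.1 hi).trans_le (le_max_left _ _)
    have hb0 : 0 < max b (1 / 2) := lt_max_of_lt_right (by norm_num)
    have hb1 : max b (1 / 2) < 1 := max_lt hb2' (by norm_num)
    obtain ⟨C, hC⟩ := belowBoundary_of_eventually_lt h ha hb0 hb1 hb hlog1 hlog2 hΘ hlin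
    have key := fun ε hε => eventually_one_sub_le_maxTypeTwoError (ε := ε) hD hs0 hA2 ha h
      ((one_lt_inv₀ hb0).2 hb1) hC hε
    have hs0n := interior_subset hs0'
    exact ⟨tendsto_minimaxGlobalError hD hs0n key,
      fun α hα0 hα1 => tendsto_minimaxTypeTwoError hD hs0n key hα0 hα1⟩
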